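/- Let $\mathbb{G}$ be a Carnot group (a simply connected Lie group whose Lie algebra $\mathfrak g$ of left invariant vector fields is stratified, $\mathfrak g=V_1\oplus\dots\oplus V_s$ with $[V_1,V_i]=V_{i+1}$ for $1\le i\le s-1$ and $[V_1,V_s]=\{0\}$). Fix a basis $X_1,\dots,X_N$ of $\mathfrak g$ adapted to the stratification (listed layer by layer) and identify $\mathbb{G}$ with $\mathbb{R}^N$ by $\exp(x_1X_1+\dots+x_NX_N)\leftrightarrow(x_1,\dots,x_N)$, so that the identity is $0$ and $x^{-1}=-x$. Let $d_i=j$ when $X_i\in V_j$, and for a multi-index $J=(j_1,\dots,j_N)\in\mathbb{N}^N$ put $|J|_{\mathbb G}=\sum_i d_i j_i$ and $x^J=\prod_i x_i^{j_i}$. Let $d$ be the Carnot–Carathéodory distance: $d(x,y)$ is the infimum of $\int_0^1|u(t)|\,dt$ over absolutely continuous curves $\gamma\colon[0,1]\to\mathbb{R}^N$ from $x$ to $y$ with $\gamma'=\sum_{j:\,d_j=1}u_jX_j(\gamma)$ almost everywhere, $u_j\in L^1[0,1]$. Let $B(x,r)$ be its balls. "Measurable" and "almost every" refer to Lebesgue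 measure $\mathcal L^N$. A set $A$ has density one at $x$ if $\mathcal L^N(B(x,r)\cap A)/\mathcal L^N(B(x,r))\to1$ as $r\to0^+$, and density zero at $x$ if its complement has density one there. For $g$ defined on $D\subset\mathbb{G}$, $\operatorname{aplim}_{y\to x}g(y)=l$ means that $\{y\in D:|g(y)-l|\le\varepsilon\}$ has density one at $x$ for every $\varepsilon>0$, and $\operatorname{aplimsup}_{y\to x}g(y)$ is the infimum of all $\lambda\in\mathbb{R}$ such that $\{y\in D:g(y)>\lambda\}$ has density zero at $x$. Let $D\subset\mathbb{G}$ be measurable and $f\colon D\to\mathbb{R}$ measurable. 1. Let $k\ge0$ be an integer. Suppose that at almost every $x_0\in D$ the function $f$ is approximately differentiable of order $k$ with polynomial $p(x_0,x)=\sum_{|J|_{\mathbb G}\le k}\alpha_J(x_0)(x_0^{-1}x)^J$, that is, $D$ has density one at $x_0$ and $$\operatorname*{aplim}_{x\to x_0}\frac{|f(x)-p(x_0,x)|}{d(x,x_0)^k}=0.$$ Then for every $J$ with $|J|_{\mathbb G}\le k$ the coefficient $\alpha_J$ is a measurable function on $D$. 2. Let $k\ge1$ be an integer. Suppose that at almost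 every $x_0\in D$ the function $f$ has the approximate $(k-1)$-Taylor polynomial $p(x_0,x)=\sum_{|J|_{\mathbb G}\le k-1}\alpha_J(x_0)(x_0^{-1}x)^J$, that is, $D$ has density one at $x_0$ and $$\operatorname*{aplimsup}_{x\to x_0}\frac{|f(x)-p(x_0,x)|}{d(x,x_0)^k}<\infty.$$ Then for every $J$ with $|J|_{\mathbb G}\le k-1$ the coefficient $\alpha_J$ is a measurable function on $D$. (At the exceptional null set of points of $D$ the $\alpha_J$ may take any values.) -/

import Mathlib

open MeasureTheory Filter Topology
open scoped ContDiff

noncomputable section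

/-- The left invariant vector field on `ℝ^N` (for a product `mul` with identity `0`) whose value
at the identity is `v`: at the point `x` it is the differential at `0` of left translation by `x`,
applied to `v`. -/
def leftField {N : ℕ} (mul : (Fin N → ℝ) → (Fin N → ℝ) → (Fin N → ℝ)) (v : Fin N → ℝ) :
    (Fin N → ℝ) → (Fin N → ℝ) :=
  fun x => fderiv ℝ (mul x) 0 v

/-- The linear span of those left invariant coordinate fields `X_i`, `X_i(0) = ∂/∂x_i`, for which
the coordinate `x_i` has homogeneity `j`. -/
def layerOf {N : ℕ} (mul : (Fin N → ℝ) → (Fin N → ℝ) → (Fin N → ℝ)) (deg : Fin N → ℕ) (j : ℕ) :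
    Submodule ℝ ((Fin N → ℝ) → (Fin N → ℝ)) :=
  Submodule.span ℝ {Y | ∃ i, deg i = j ∧ Y = leftField mul (Pi.single i 1)}

/-- `[V, W]`, the linear span of all brackets `[A, B]` with `A ∈ V`, `B ∈ W`. -/
def bracketSpan {N : ℕ} (V W : Submodule ℝ ((Fin N → ℝ) → (Fin N → ℝ))) :
    Submodule ℝ ((Fin N → ℝ) → (Fin N → ℝ)) :=
  Submodule.span ℝ {Z | ∃ A ∈ V, ∃ B ∈ W, Z = VectorField.lieBracket ℝ A B}

/-- A Carnot group of step `s` and topological dimension `N`, identified with `ℝ^N` through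
exponential coordinates with respect to a basis `X_1, …, X_N` of its Lie algebra adapted to the
stratification: the point `x` stands for `exp (x_1 X_1 + … + x_N X_N)`.
The Lie algebra is the space of left invariant vector fields with the bracket of vector fields. -/
structure CarnotGroup (N s : ℕ) where
  /-- the group product in coordinates -/
  mul : (Fin N → ℝ) → (Fin N → ℝ) → (Fin N → ℝ)
  /-- the product is smooth (so is the inversion, which is `x ↦ -x`) -/
  contDiff_mul : ContDiff ℝ ∞ (fun p : (Fin N → ℝ) × (Fin N → ℝ) => mul p.1 p.2)
  mul_assoc : ∀ x y z, mul (mul x y) z = mul x (mul y z)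
  /-- the coordinates are exponential: `t ↦ t x` is a one-parameter subgroup (the one with
  initial velocity `x`). For `a = 0` or `b = 0` this says that `0` is the identity, and for
  `a + b = 0` that `-x` is the inverse of `x`. -/
  smul_mul_smul : ∀ (a b : ℝ) (x : Fin N → ℝ), mul (a • x) (b • x) = (a + b) • x
  /-- `deg i` is the homogeneity `d_i` of the coordinate `x_i`: the index of the layer that
  contains `X_i` -/
  deg : Fin N → ℕ
  deg_pos : ∀ i, 1 ≤ deg i
  deg_le : ∀ i, deg i ≤ s
  /-- the basis is ordered by layers -/
  deg_mono : Monotone deg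
  /-- `[V_1, V_j] = V_{j+1}` for `1 ≤ j ≤ s - 1` -/
  bracket_layer : ∀ j, 1 ≤ j → j < s →
    bracketSpan (layerOf mul deg 1) (layerOf mul deg j) = layerOf mul deg (j + 1)
  /-- `[V_1, V_s] = 0` -/
  bracket_top : bracketSpan (layerOf mul deg 1) (layerOf mul deg s) = ⊥

namespace CarnotGroup

variable {N s : ℕ} (G : CarnotGroup N s)

theorem zero_mul (x : Fin N → ℝ) : G.mul 0 x = x := by
  simpa using G.smul_mul_smul 0 1 x

theorem mul_zero (x : Fin N → ℝ) : G.mul x 0 = x := by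
  simpa using G.smul_mul_smul 1 0 x

theorem neg_mul_self (x : Fin N → ℝ) : G.mul (-x) x = 0 := by
  simpa using G.smul_mul_smul (-1) 1 x

/-- The basis vector field `X_i`. -/
def X (i : Fin N) : (Fin N → ℝ) → (Fin N → ℝ) := leftField G.mul (Pi.single i 1)

/-! ### Horizontal curves and the Carnot-Caratheodory distance -/

/-- The curve `γ : [a, b] → ℝ^N` is absolutely continuous: differentiable almost everywhere, with
integrable derivative, and the integral of its derivative. -/
def IsAbsCont (γ : ℝ → Fin N → ℝ) (a b : ℝ) : Prop :=
  (∀ᵐ t ∂volume.restrict (Set.Icc a b), DifferentiableAt ℝ γ t) ∧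
  IntegrableOn (deriv γ) (Set.Icc a b) volume ∧
  ∀ t₁ ∈ Set.Icc a b, ∀ t₂ ∈ Set.Icc a b, γ t₂ - γ t₁ = ∫ t in t₁..t₂, deriv γ t

/-- The curve `γ` is horizontal on `[a, b]` with controls `u_j`, one for each `j` with `X_j` in the
first layer: `γ' = ∑ u_j X_j(γ)` almost everywhere, with `u_j` integrable. -/
def IsHorizontal (γ : ℝ → Fin N → ℝ) (u : {i : Fin N // G.deg i = 1} → ℝ → ℝ) (a b : ℝ) : Prop :=
  IsAbsCont γ a b ∧
  (∀ j, IntegrableOn (u j) (Set.Icc a b) volume) ∧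
  ∀ᵐ t ∂volume.restrict (Set.Icc a b), deriv γ t = ∑ j, u j t • G.X j (γ t)

/-- The horizontal length: the integral of the Euclidean norm of the controls. -/
def horizontalLength (u : {i : Fin N // G.deg i = 1} → ℝ → ℝ) (a b : ℝ) : ℝ :=
  ∫ t in a..b, Real.sqrt (∑ j, (u j t) ^ 2)

/-- The Carnot-Caratheodory distance. -/
def ccDist (x y : Fin N → ℝ) : ℝ :=
  sInf {L | ∃ γ u, G.IsHorizontal γ u 0 1 ∧ γ 0 = x ∧ γ 1 = y ∧ L = G.horizontalLength u 0 1}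

def ccBall (x : Fin N → ℝ) (r : ℝ) : Set (Fin N → ℝ) := {y | G.ccDist x y < r}

/-! ### Density and approximate limits -/

/-- `A` has density one at `x`. -/
def DensityOne (A : Set (Fin N → ℝ)) (x : Fin N → ℝ) : Prop :=
  Tendsto (fun r : ℝ => volume (G.ccBall x r ∩ A) / volume (G.ccBall x r)) (𝓝[>] 0) (𝓝 1)

/-- `A` has density zero at `x`. -/
def DensityZero (A : Set (Fin N → ℝ)) (x : Fin N → ℝ) : Prop := G.DensityOne Aᶜ x

/-- `aplim_{y → x} g(y) = l` for `g` defined on `D`; the values of `g` off `D` play no role. -/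
def HasApLim (D : Set (Fin N → ℝ)) (g : (Fin N → ℝ) → ℝ) (x : Fin N → ℝ) (l : ℝ) : Prop :=
  ∀ ε > 0, G.DensityOne {y | y ∈ D ∧ |g y - l| ≤ ε} x

/-- `aplimsup_{y → x} g(y)` for `g` defined on `D`, as an extended real number; the values of `g`
off `D` play no role. -/
def apLimsup (D : Set (Fin N → ℝ)) (g : (Fin N → ℝ) → ℝ) (x : Fin N → ℝ) : EReal :=
  sInf {l : EReal | ∃ c : ℝ, l = (c : EReal) ∧ G.DensityZero {y | y ∈ D ∧ c < g y} x}

/-! ### Polynomials -/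

/-- The homogeneous norm `|J|_𝔾 = ∑ d_i j_i` of a multi-index. -/
def hdeg (J : Fin N → ℕ) : ℕ := ∑ i, G.deg i * J i

/-- The finite set of multi-indices `J` with `|J|_𝔾 ≤ k`. -/
def multiIndices (k : ℕ) : Finset (Fin N → ℕ) :=
  (Fintype.piFinset fun _ => Finset.range (k + 1)).filter fun J => G.hdeg J ≤ k

theorem mem_multiIndices {k : ℕ} {J : Fin N → ℕ} : J ∈ G.multiIndices k ↔ G.hdeg J ≤ k := by
  simp only [multiIndices, Finset.mem_filter, Fintype.mem_piFinset, Finset.mem_range,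
    and_iff_right_iff_imp]
  intro h i
  have h1 : G.deg i * J i ≤ G.hdeg J :=
    Finset.single_le_sum (f := fun i => G.deg i * J i) (fun _ _ => Nat.zero_le _)
      (Finset.mem_univ i)
  have h2 : J i ≤ G.deg i * J i := Nat.le_mul_of_pos_left _ (G.deg_pos i)
  omega

/-- The polynomial `x ↦ ∑_{|J|_𝔾 ≤ k} c_J (x₀⁻¹ x)^J` centred at `x₀`. -/
def centredPoly (k : ℕ) (c : (Fin N → ℕ) → ℝ) (x₀ x : Fin N → ℝ) : ℝ :=
  ∑ J ∈ G.multiIndices k, c J * ∏ i, (G.mul (-x₀) x i) ^ J i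

/-! ### Approximate derivatives and approximate Taylor polynomials -/

/-- `f`, defined on `D`, is approximately differentiable of order `k` at `x₀`, a point of `D` at
which `D` has density one, with polynomial `∑_{|J|_𝔾 ≤ k} c_J (x₀⁻¹ x)^J`. -/
def HasApproxDeriv (D : Set (Fin N → ℝ)) (f : (Fin N → ℝ) → ℝ) (k : ℕ) (x₀ : Fin N → ℝ)
    (c : (Fin N → ℕ) → ℝ) : Prop :=
  x₀ ∈ D ∧ G.DensityOne D x₀ ∧
    G.HasApLim D (fun x => |f x - G.centredPoly k c x₀ x| / G.ccDist x x₀ ^ k) x₀ 0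

/-- `f`, defined on `D`, has at `x₀`, a point of `D` at which `D` has density one, the approximate
`(k-1)`-Taylor polynomial `∑_{|J|_𝔾 ≤ k-1} c_J (x₀⁻¹ x)^J`. Meant for `k ≥ 1`. -/
def HasApproxTaylor (D : Set (Fin N → ℝ)) (f : (Fin N → ℝ) → ℝ) (k : ℕ) (x₀ : Fin N → ℝ)
    (c : (Fin N → ℕ) → ℝ) : Prop :=
  x₀ ∈ D ∧ G.DensityOne D x₀ ∧
    G.apLimsup D (fun x => |f x - G.centredPoly (k - 1) c x₀ x| / G.ccDist x x₀ ^ k) x₀ < ⊤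

end CarnotGroup

/-- `g` is a Lebesgue measurable function on `D`: the part in `D` of the preimage of each Borel set
is Lebesgue measurable. The values of `g` off `D` play no role. -/
def LebesgueMeasurableOn {N : ℕ} (D : Set (Fin N → ℝ)) (g : (Fin N → ℝ) → ℝ) : Prop :=
  ∀ B : Set ℝ, MeasurableSet B → NullMeasurableSet (D ∩ g ⁻¹' B) volume

end

/-!
The coefficients are measurable because their graph is, over almost every point of `D`, the
restriction of a Borel set on which the projection to the base point is injective; the
Lusin-Souslin theorem turns Borel subsets of that set into Borel sets of base points
(`lebesgueMeasurableOn_coeff`).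

The Borel set is `taylorGraph`. The map `v ↦ x δ_r(v)` (`zoom`) carries the unit ball of the
Carnot-Caratheodory distance to the ball of radius `r` about `x` and multiplies Lebesgue measure by
a constant. Approximate differentiability of order `k` at `x` with coefficients `c` therefore says
that `r ^ (-k) (f (x δ_r v) - ∑ c_J (δ_r v)^J)` tends to `0` in measure on the unit ball. Along
`r = 1 / (n + 1)` and with a Borel representative of `f`, this is a Borel condition on `(x, c)`.
A bound of order `k` on the remainder of a polynomial of degree `k - 1` gives the same condition
with `k - 1` in place of `k`, so both assertions are covered.

Injectivity is uniqueness of the polynomial (`eq_of_mem_taylorGraph`). For two candidates the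
rescaled difference tends to `0` almost everywhere along a subsequence. Along the dilation orbit of
`v` the difference is a polynomial in `r` of degree at most `k`, so being `o(r ^ k)` it vanishes.
Hence the difference vanishes on the unit ball, which contains a neighbourhood of the identity.

The geometry this needs is derived from the structure of the group.
* Dilations push left invariant fields to left invariant fields (`dil_dL`). They are automorphisms
  of the graded Lie algebra, and in exponential coordinates the inverse of the left invariant frame,
  taken along a ray and multiplied by the parameter, solves a linear differential equation whose
  only coefficient is the adjoint map of the direction (`hasDerivAt_smul_dLInv`). Consequently the
  distance is homogeneous (`ccDist_dil`), and the frame has determinant one (`det_dL`), so that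
  left translations preserve Lebesgue measure.
* Any two points are joined by a horizontal curve, and the distance is continuous
  (`lengths_nonempty`, `continuous_ccDist`). The span of the conjugates of horizontal directions
  by the points reached from the identity is stable under brackets with the first layer, so it is
  the whole Lie algebra (`span_reachableDirections`). A product of conjugates of horizontal
  one-parameter subgroups is thus a submersion at the identity, which bounds the distance near the
  identity, and dilations do the rest.

The finiteness of the volume of the unit ball is read off the existence of a point of density.
-/

theorem minSmoothness_two_le : minSmoothness ℝ 2 ≤ (∞ : WithTop ℕ∞) := by
  rw [minSmoothness_of_isRCLikeNormedField]
  exact WithTop.coe_le_coe.2 (le_top : (2 : ℕ∞) ≤ ⊤)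

namespace CarnotGroup

variable {N s : ℕ} (G : CarnotGroup N s)

/-! ### Left translations and left invariant fields -/

theorem mul_neg_self (x : Fin N → ℝ) : G.mul x (-x) = 0 := by
  simpa using G.smul_mul_smul 1 (-1) x

theorem neg_mul_cancel_left (x y : Fin N → ℝ) : G.mul (-x) (G.mul x y) = y := by
  rw [← G.mul_assoc, G.neg_mul_self, G.zero_mul]

theorem mul_neg_cancel_left (x y : Fin N → ℝ) : G.mul x (G.mul (-x) y) = y := by
  rw [← G.mul_assoc, G.mul_neg_self, G.zero_mul]

theorem neg_mul_rev (x y : Fin N → ℝ) : -(G.mul x y) = G.mul (-y) (-x) := by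
  have h : G.mul (G.mul x y) (G.mul (-y) (-x)) = 0 := by
    rw [G.mul_assoc, G.mul_neg_cancel_left, G.mul_neg_self]
  rw [← G.neg_mul_cancel_left (G.mul x y) (G.mul (-y) (-x)), h, G.mul_zero]

theorem contDiff_mul_left (x : Fin N → ℝ) : ContDiff ℝ ∞ (G.mul x) :=
  G.contDiff_mul.comp (contDiff_const.prodMk contDiff_id)

theorem contDiff_mul_right (y : Fin N → ℝ) : ContDiff ℝ ∞ (fun x => G.mul x y) :=
  G.contDiff_mul.comp (contDiff_id.prodMk contDiff_const)

theorem continuous_mul : Continuous fun p : (Fin N → ℝ) × (Fin N → ℝ) => G.mul p.1 p.2 :=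
  G.contDiff_mul.continuous

theorem differentiable_mul_left (x : Fin N → ℝ) : Differentiable ℝ (G.mul x) :=
  (G.contDiff_mul_left x).differentiable (by simp)

/-- The differential at the identity of left translation by `x`: it sends `v` to the value at `x`
of the left invariant field with value `v` at the identity. -/
noncomputable def dL (x : Fin N → ℝ) : (Fin N → ℝ) →L[ℝ] (Fin N → ℝ) := fderiv ℝ (G.mul x) 0

theorem leftField_apply (v x : Fin N → ℝ) : leftField G.mul v x = G.dL x v := rfl

theorem contDiff_dL : ContDiff ℝ ∞ G.dL :=
  ContDiff.fderiv (m := ∞) (n := ∞) (f := G.mul) G.contDiff_mul contDiff_const (by simp)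

theorem differentiable_dL : Differentiable ℝ G.dL := G.contDiff_dL.differentiable (by simp)

theorem contDiff_leftField (v : Fin N → ℝ) : ContDiff ℝ ∞ (leftField G.mul v) :=
  G.contDiff_dL.clm_apply contDiff_const

theorem dL_zero : G.dL 0 = ContinuousLinearMap.id ℝ _ := by
  have : G.mul 0 = id := funext G.zero_mul
  rw [dL, this, fderiv_id]

theorem fderiv_mul_left_comp_dL (x y : Fin N → ℝ) :
    (fderiv ℝ (G.mul x) y).comp (G.dL y) = G.dL (G.mul x y) := by
  have h : G.mul (G.mul x y) = G.mul x ∘ G.mul y := funext (G.mul_assoc x y)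
  rw [dL, dL, h, fderiv_comp _ (G.differentiable_mul_left x _) (G.differentiable_mul_left y _),
    G.mul_zero]

theorem fderiv_mul_left_dL (x y v : Fin N → ℝ) :
    fderiv ℝ (G.mul x) y (G.dL y v) = G.dL (G.mul x y) v :=
  congrArg (fun A => A v) (G.fderiv_mul_left_comp_dL x y)

/-- The inverse of `dL x`. -/
noncomputable def dLInv (x : Fin N → ℝ) : (Fin N → ℝ) →L[ℝ] (Fin N → ℝ) :=
  fderiv ℝ (G.mul (-x)) x

theorem dLInv_comp_dL (x : Fin N → ℝ) : (G.dLInv x).comp (G.dL x) = .id ℝ _ := by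
  rw [dLInv, G.fderiv_mul_left_comp_dL, G.neg_mul_self, G.dL_zero]

theorem dL_comp_dLInv (x : Fin N → ℝ) : (G.dL x).comp (G.dLInv x) = .id ℝ _ := by
  have h : G.mul x ∘ G.mul (-x) = id := funext (G.mul_neg_cancel_left x)
  rw [dL, dLInv, ← fderiv_id (x := x), ← h,
    fderiv_comp _ (G.differentiable_mul_left x _) (G.differentiable_mul_left _ _), G.neg_mul_self]

theorem dL_dLInv (x v : Fin N → ℝ) : G.dL x (G.dLInv x v) = v :=
  congrArg (fun A => A v) (G.dL_comp_dLInv x)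

theorem dLInv_dL (x v : Fin N → ℝ) : G.dLInv x (G.dL x v) = v :=
  congrArg (fun A => A v) (G.dLInv_comp_dL x)

theorem differentiable_dLInv : Differentiable ℝ G.dLInv := by
  have : ContDiff ℝ ∞ G.dLInv :=
    ContDiff.fderiv (m := ∞) (n := ∞) (f := fun x y => G.mul (-x) y) (g := fun x => x)
      (G.contDiff_mul.comp ((contDiff_neg.comp contDiff_fst).prodMk contDiff_snd)) contDiff_id
      (by simp)
  exact this.differentiable (by simp)

/-- In exponential coordinates the radial line through `x` is an integral curve of the left
invariant field with value `x` at the identity. -/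
theorem dL_self (x : Fin N → ℝ) : G.dL x x = x := by
  have h1 : HasDerivAt (fun t : ℝ => t • x) x 0 := by
    simpa using (hasDerivAt_id (0 : ℝ)).smul_const x
  have h2 : HasFDerivAt (G.mul x) (G.dL x) ((0 : ℝ) • x) := by
    rw [zero_smul]; exact (G.differentiable_mul_left x 0).hasFDerivAt
  have h3 := h2.comp_hasDerivAt (0 : ℝ) h1
  have h4 : G.mul x ∘ (fun t : ℝ => t • x) = fun t => x + t • x := by
    funext t
    simpa [add_smul] using G.smul_mul_smul 1 t x
  rw [h4] at h3
  exact h3.unique (h1.const_add x)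

/-- The Lie bracket of the Lie algebra of left invariant fields, transported to the tangent space
at the identity. -/
noncomputable def bracket : (Fin N → ℝ) →L[ℝ] (Fin N → ℝ) →L[ℝ] (Fin N → ℝ) :=
  fderiv ℝ G.dL 0 - (fderiv ℝ G.dL 0).flip

theorem fderiv_leftField (v x z : Fin N → ℝ) :
    fderiv ℝ (leftField G.mul v) x z = fderiv ℝ G.dL x z v := by
  have h : HasFDerivAt (leftField G.mul v) _ x :=
    (G.differentiable_dL x).hasFDerivAt.clm_apply (hasFDerivAt_const v x)
  rw [h.fderiv]
  simp

theorem lieBracket_leftField (v w x : Fin N → ℝ) :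
    VectorField.lieBracket ℝ (leftField G.mul v) (leftField G.mul w) x =
      G.dL x (G.bracket v w) := by
  have hinv : (fderiv ℝ (G.mul x) 0).IsInvertible :=
    ContinuousLinearMap.IsInvertible.of_inverse (G.dL_comp_dLInv x) (G.dLInv_comp_dL x)
  have hpull (u : Fin N → ℝ) :
      VectorField.pullback ℝ (G.mul x) (leftField G.mul u) = leftField G.mul u := by
    funext y
    have hy : (fderiv ℝ (G.mul x) y).IsInvertible := by
      have : fderiv ℝ (G.mul x) y = (G.dL (G.mul x y)).comp (G.dLInv y) := by
        rw [← G.fderiv_mul_left_comp_dL, ContinuousLinearMap.comp_assoc, G.dL_comp_dLInv,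
          ContinuousLinearMap.comp_id]
      rw [this]
      exact (ContinuousLinearMap.IsInvertible.of_inverse (G.dL_comp_dLInv _)
        (G.dLInv_comp_dL _)).comp
        (ContinuousLinearMap.IsInvertible.of_inverse (G.dLInv_comp_dL _) (G.dL_comp_dLInv _))
    rw [VectorField.pullback, G.leftField_apply, ← G.fderiv_mul_left_dL, G.leftField_apply,
      hy.inverse_apply_eq]
  have key := VectorField.pullback_lieBracket (𝕜 := ℝ) (n := ∞) (f := G.mul x) (x := 0)
    (V := leftField G.mul v) (W := leftField G.mul w)
    minSmoothness_two_le
    (G.contDiff_mul_left x).contDiffAt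
    ((G.contDiff_leftField v).differentiable (by simp) _)
    ((G.contDiff_leftField w).differentiable (by simp) _)
  rw [hpull, hpull, VectorField.pullback, G.mul_zero, hinv.inverse_apply_eq] at key
  rw [key, VectorField.lieBracket_eq]
  simp only [G.fderiv_leftField, G.leftField_apply, G.dL_zero, bracket]
  rfl

/-! ### The grading of the Lie algebra -/

/-- The tangent vectors at the identity that belong to the `j`-th layer. -/
def layer (j : ℕ) : Submodule ℝ (Fin N → ℝ) where
  carrier := {v | ∀ i, G.deg i ≠ j → v i = 0}
  add_mem' := fun {v w} hv hw i hi => by simp [hv i hi, hw i hi]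
  zero_mem' := fun _ _ => rfl
  smul_mem' := fun c v hv i hi => by simp [hv i hi]

theorem single_mem_layer (i : Fin N) (c : ℝ) : Pi.single i c ∈ G.layer (G.deg i) := by
  intro k hk
  have : k ≠ i := fun h => hk (by rw [h])
  simp [this]

theorem layer_eq_bot {j : ℕ} (hj : s < j) : G.layer j = ⊥ := by
  refine (Submodule.eq_bot_iff _).2 fun v hv => funext fun i => hv i ?_
  have := G.deg_le i
  omega

theorem leftField_mem_layerOf {j : ℕ} {v : Fin N → ℝ} (hv : v ∈ G.layer j) :
    leftField G.mul v ∈ layerOf G.mul G.deg j := by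
  have h : leftField G.mul v = ∑ i, v i • leftField G.mul (Pi.single i 1) := by
    funext x
    simp only [Finset.sum_apply, Pi.smul_apply, G.leftField_apply]
    conv_lhs => rw [pi_eq_sum_univ' v, map_sum]
    simp only [map_smul]
  rw [h]
  refine Submodule.sum_mem _ fun i _ => ?_
  by_cases hi : G.deg i = j
  · exact Submodule.smul_mem _ _ (Submodule.subset_span ⟨i, hi, rfl⟩)
  · rw [hv i hi, zero_smul]; exact Submodule.zero_mem _

theorem apply_zero_mem_layer {j : ℕ} {Y : (Fin N → ℝ) → (Fin N → ℝ)}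
    (hY : Y ∈ layerOf G.mul G.deg j) : Y 0 ∈ G.layer j := by
  induction hY using Submodule.span_induction with
  | mem Y h =>
    obtain ⟨i, rfl, rfl⟩ := h
    rw [G.leftField_apply, G.dL_zero]
    exact G.single_mem_layer i 1
  | zero => exact Submodule.zero_mem _
  | add Y Z _ _ h1 h2 => exact Submodule.add_mem _ h1 h2
  | smul c Y _ h => exact Submodule.smul_mem _ _ h

theorem exists_of_mem_layerOf {j : ℕ} {Y : (Fin N → ℝ) → (Fin N → ℝ)}
    (hY : Y ∈ layerOf G.mul G.deg j) : ∃ v ∈ G.layer j, Y = leftField G.mul v := by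
  induction hY using Submodule.span_induction with
  | mem Y h =>
    obtain ⟨i, rfl, rfl⟩ := h
    exact ⟨_, G.single_mem_layer i 1, rfl⟩
  | zero => exact ⟨0, Submodule.zero_mem _, by funext x; simp [G.leftField_apply]⟩
  | add Y Z _ _ h1 h2 =>
    obtain ⟨v, hv, rfl⟩ := h1
    obtain ⟨w, hw, rfl⟩ := h2
    exact ⟨v + w, Submodule.add_mem _ hv hw, by funext x; simp [G.leftField_apply]⟩
  | smul c Y _ h =>
    obtain ⟨v, hv, rfl⟩ := h
    exact ⟨c • v, Submodule.smul_mem _ _ hv, by funext x; simp [G.leftField_apply]⟩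

theorem lieBracket_leftField_zero (v w : Fin N → ℝ) :
    VectorField.lieBracket ℝ (leftField G.mul v) (leftField G.mul w) 0 = G.bracket v w := by
  rw [G.lieBracket_leftField, G.dL_zero]; rfl

theorem bracket_horizontal_mem {j : ℕ} (hj : 1 ≤ j) {v w : Fin N → ℝ} (hv : v ∈ G.layer 1)
    (hw : w ∈ G.layer j) : G.bracket v w ∈ G.layer (j + 1) := by
  have hmem : VectorField.lieBracket ℝ (leftField G.mul v) (leftField G.mul w) ∈
      bracketSpan (layerOf G.mul G.deg 1) (layerOf G.mul G.deg j) :=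
    Submodule.subset_span ⟨_, G.leftField_mem_layerOf hv, _, G.leftField_mem_layerOf hw, rfl⟩
  rcases lt_trichotomy j s with h | h | h
  · rw [G.bracket_layer j hj h] at hmem
    rw [← G.lieBracket_leftField_zero]
    exact G.apply_zero_mem_layer hmem
  · rw [h, G.bracket_top, Submodule.mem_bot] at hmem
    rw [← G.lieBracket_leftField_zero, hmem]
    exact Submodule.zero_mem _
  · rw [G.layer_eq_bot h, Submodule.mem_bot] at hw
    rw [hw, map_zero]
    exact Submodule.zero_mem _

theorem layer_succ_le {j : ℕ} (hj : 1 ≤ j) :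
    G.layer (j + 1) ≤ Submodule.span ℝ
      {z | ∃ v ∈ G.layer 1, ∃ w ∈ G.layer j, z = G.bracket v w} := by
  intro z hz
  rcases lt_or_ge j s with h | h
  · have h1 := G.leftField_mem_layerOf hz
    rw [← G.bracket_layer j hj h] at h1
    have h2 : z = leftField G.mul z 0 := by rw [G.leftField_apply, G.dL_zero]; rfl
    rw [h2]
    generalize leftField G.mul z = Z at h1
    induction h1 using Submodule.span_induction with
    | mem Y h =>
      obtain ⟨A, hA, B, hB, rfl⟩ := h
      obtain ⟨v, hv, rfl⟩ := G.exists_of_mem_layerOf hA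
      obtain ⟨w, hw, rfl⟩ := G.exists_of_mem_layerOf hB
      exact Submodule.subset_span ⟨v, hv, w, hw, G.lieBracket_leftField_zero v w⟩
    | zero => exact Submodule.zero_mem _
    | add Y Z _ _ h1 h2 => exact Submodule.add_mem _ h1 h2
    | smul c Y _ h => exact Submodule.smul_mem _ _ h
  · rw [G.layer_eq_bot (by omega), Submodule.mem_bot] at hz
    rw [hz]
    exact Submodule.zero_mem _

theorem lieBracket_leftField_eq (v w : Fin N → ℝ) :
    VectorField.lieBracket ℝ (leftField G.mul v) (leftField G.mul w) =
      leftField G.mul (G.bracket v w) :=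
  funext fun x => G.lieBracket_leftField v w x

theorem bracket_jacobi (u v w : Fin N → ℝ) :
    G.bracket u (G.bracket v w) =
      G.bracket (G.bracket u v) w + G.bracket v (G.bracket u w) := by
  have h := VectorField.leibniz_identity_lieBracket (𝕜 := ℝ) (n := ∞)
    minSmoothness_two_le
    (U := leftField G.mul u) (V := leftField G.mul v) (W := leftField G.mul w) (x := 0)
    (G.contDiff_leftField u).contDiffAt (G.contDiff_leftField v).contDiffAt
    (G.contDiff_leftField w).contDiffAt
  simpa only [G.lieBracket_leftField_eq, G.lieBracket_leftField_zero] using h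

theorem bracket_mem_layer {i j : ℕ} (hi : 1 ≤ i) (hj : 1 ≤ j) {v w : Fin N → ℝ}
    (hv : v ∈ G.layer i) (hw : w ∈ G.layer j) : G.bracket v w ∈ G.layer (i + j) := by
  induction i, hi using Nat.le_induction generalizing v w j with
  | base => rw [add_comm]; exact G.bracket_horizontal_mem hj hv hw
  | succ i hi ih =>
    have hv' := G.layer_succ_le hi hv
    clear hv
    induction hv' using Submodule.span_induction with
    | mem z hz =>
      obtain ⟨a, ha, b, hb, rfl⟩ := hz
      have h1 : G.bracket (G.bracket a b) w =
          G.bracket a (G.bracket b w) - G.bracket b (G.bracket a w) := by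
        rw [G.bracket_jacobi a b w, add_sub_cancel_right]
      rw [h1]
      refine Submodule.sub_mem _ ?_ ?_
      · have := G.bracket_horizontal_mem (by omega) ha (ih hj hb hw)
        rwa [show i + 1 + j = i + j + 1 by omega]
      · have := ih (by omega) hb (G.bracket_horizontal_mem hj ha hw)
        rwa [show i + 1 + j = i + (j + 1) by omega]
    | zero => simp
    | add y z _ _ h1 h2 =>
      rw [map_add]; exact Submodule.add_mem _ h1 h2
    | smul c y _ h => rw [map_smul]; exact Submodule.smul_mem _ _ h

/-- The first layer generates the Lie algebra. -/
theorem eq_top_of_horizontal {W : Submodule ℝ (Fin N → ℝ)} (h1 : G.layer 1 ≤ W)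
    (h2 : ∀ v ∈ G.layer 1, ∀ w ∈ W, G.bracket v w ∈ W) : W = ⊤ := by
  have hle : ∀ j, 1 ≤ j → G.layer j ≤ W := by
    intro j hj
    induction j, hj using Nat.le_induction with
    | base => exact h1
    | succ j hj ih =>
      refine (G.layer_succ_le hj).trans (Submodule.span_le.2 ?_)
      rintro _ ⟨v, hv, w, hw, rfl⟩
      exact h2 v hv w (ih hw)
  refine (Submodule.eq_top_iff').2 fun v => ?_
  rw [← Finset.univ_sum_single v]
  exact Submodule.sum_mem _ fun i _ => hle _ (G.deg_pos i) (G.single_mem_layer i (v i))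

/-! ### Dilations -/

/-- The dilation of ratio `r`, which multiplies the coordinate `x_i` by `r ^ d_i`. -/
noncomputable def dil (r : ℝ) : (Fin N → ℝ) →L[ℝ] (Fin N → ℝ) :=
  ContinuousLinearMap.pi fun i => r ^ G.deg i • ContinuousLinearMap.proj i

@[simp]
theorem dil_apply (r : ℝ) (v : Fin N → ℝ) (i : Fin N) : G.dil r v i = r ^ G.deg i * v i := rfl

theorem dil_dil (r t : ℝ) (v : Fin N → ℝ) : G.dil r (G.dil t v) = G.dil (r * t) v := by
  ext i; simp only [dil_apply, mul_pow]; ring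

theorem dil_one (v : Fin N → ℝ) : G.dil 1 v = v := by ext i; simp

theorem dil_inv_dil {r : ℝ} (hr : r ≠ 0) (v : Fin N → ℝ) : G.dil r⁻¹ (G.dil r v) = v := by
  rw [dil_dil, inv_mul_cancel₀ hr, dil_one]

theorem dil_dil_inv {r : ℝ} (hr : r ≠ 0) (v : Fin N → ℝ) : G.dil r (G.dil r⁻¹ v) = v := by
  rw [dil_dil, mul_inv_cancel₀ hr, dil_one]

theorem dil_of_mem_layer {r : ℝ} {j : ℕ} {v : Fin N → ℝ} (hv : v ∈ G.layer j) :
    G.dil r v = r ^ j • v := by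
  ext i
  by_cases hi : G.deg i = j
  · simp [hi]
  · simp [hv i hi]

theorem dil_zero : G.dil 0 = 0 := by
  ext v i
  have := G.deg_pos i
  simp [zero_pow (M₀ := ℝ) (show G.deg i ≠ 0 by omega)]

theorem continuous_dil_left (v : Fin N → ℝ) : Continuous fun r => G.dil r v :=
  continuous_pi fun i => (continuous_pow (G.deg i)).mul continuous_const

theorem dil_bracket (r : ℝ) (v w : Fin N → ℝ) :
    G.dil r (G.bracket v w) = G.bracket (G.dil r v) (G.dil r w) := by
  have hbasis (i j : Fin N) (a b : ℝ) :
      G.dil r (G.bracket (Pi.single i a) (Pi.single j b)) =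
        G.bracket (G.dil r (Pi.single i a)) (G.dil r (Pi.single j b)) := by
    rw [G.dil_of_mem_layer (G.bracket_mem_layer (G.deg_pos i) (G.deg_pos j)
      (G.single_mem_layer i a) (G.single_mem_layer j b)),
      G.dil_of_mem_layer (G.single_mem_layer i a), G.dil_of_mem_layer (G.single_mem_layer j b)]
    simp [pow_add, smul_smul, mul_comm]
  rw [← Finset.univ_sum_single v, ← Finset.univ_sum_single w]
  simp only [map_sum, sum_apply, hbasis]

/-- The Riccati equation for the left invariant frame along a ray. It is the bracket of the field
`X_x` with an arbitrary left invariant field, computed at `x` with the help of `dL_self`. -/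
theorem fderiv_dL_radial (x w : Fin N → ℝ) :
    fderiv ℝ G.dL x x w = G.dL x w - G.dL x (G.dL x w) + G.dL x (G.bracket x w) := by
  have h1 : ∀ z, fderiv ℝ G.dL x z x + G.dL x z = z := by
    intro z
    have h : HasFDerivAt (fun y => G.dL y y) _ x :=
      (G.differentiable_dL x).hasFDerivAt.clm_apply (hasFDerivAt_id x)
    have h' : (fun y => G.dL y y) = id := funext G.dL_self
    rw [h'] at h
    have := congrArg (fun A => A z) (h.unique (hasFDerivAt_id x))
    simpa [add_comm] using this
  have h2 := G.lieBracket_leftField x w x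
  rw [VectorField.lieBracket_eq] at h2
  simp only [G.fderiv_leftField, G.leftField_apply, G.dL_self] at h2
  have h3 := h1 (G.dL x w)
  rw [← h2, ← sub_eq_iff_eq_add.2 h3.symm]
  abel

theorem hasDerivAt_smul_dLInv (x : Fin N → ℝ) (t : ℝ) :
    HasDerivAt (fun t : ℝ => t • G.dLInv (t • x))
      (.id ℝ _ - (G.bracket x).comp (t • G.dLInv (t • x))) t := by
  have hray : HasDerivAt (fun t : ℝ => t • x) x t := by
    simpa using (hasDerivAt_id t).smul_const x
  have hM : HasDerivAt (fun t : ℝ => G.dLInv (t • x)) (fderiv ℝ G.dLInv (t • x) x) t :=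
    HasFDerivAt.comp_hasDerivAt (f := fun t : ℝ => t • x) t
      (G.differentiable_dLInv (t • x)).hasFDerivAt hray
  have hA : HasDerivAt (fun t : ℝ => G.dL (t • x)) (fderiv ℝ G.dL (t • x) x) t :=
    HasFDerivAt.comp_hasDerivAt (f := fun t : ℝ => t • x) t
      (G.differentiable_dL (t • x)).hasFDerivAt hray
  have hMA := hM.clm_comp hA
  have hconst : (fun t : ℝ => (G.dLInv (t • x)).comp (G.dL (t • x))) = fun _ => .id ℝ _ :=
    funext fun t => G.dLInv_comp_dL _
  rw [hconst] at hMA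
  have h0 := hMA.unique (hasDerivAt_const t _)
  have key := (hasDerivAt_id t).smul hM
  refine key.congr_deriv ?_
  ext1 z
  have h1 := congrArg (fun A => A (G.dLInv (t • x) z)) h0
  simp only [_root_.add_apply, ContinuousLinearMap.comp_apply, G.dL_dLInv,
    _root_.zero_apply] at h1
  have h2 := G.fderiv_dL_radial (t • x) (G.dLInv (t • x) z)
  simp only [map_smul, _root_.smul_apply, G.dL_dLInv] at h2
  have h3 := congrArg (G.dLInv (t • x)) h2
  simp only [map_add, map_sub, map_smul, G.dLInv_dL] at h3
  have h4 : t • (fderiv ℝ G.dLInv (t • x) x) z =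
      -(G.dLInv (t • x) z - z + t • G.bracket x (G.dLInv (t • x) z)) := by
    rw [← h3, ← smul_neg, ← eq_neg_of_add_eq_zero_left h1]
  simp only [id, one_smul, _root_.add_apply, _root_.smul_apply,
    _root_.sub_apply, ContinuousLinearMap.comp_apply, map_smul,
    ContinuousLinearMap.id_apply] 
  rw [h4]
  abel

theorem dil_comp_dLInv (r : ℝ) (x : Fin N → ℝ) :
    (G.dil r).comp (G.dLInv x) = (G.dLInv (G.dil r x)).comp (G.dil r) := by
  -- Both sides, taken along the ray through `x`, solve the same linear initial value problem.
  set δ := G.dil r with hδ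
  let F : ℝ → ((Fin N → ℝ) →L[ℝ] (Fin N → ℝ)) → ((Fin N → ℝ) →L[ℝ] (Fin N → ℝ)) :=
    fun _ P => δ - (G.bracket (δ x)).comp P
  have hF : ∀ t, LipschitzWith ‖G.bracket (δ x)‖₊ (F t) := fun t => by
    refine LipschitzWith.of_dist_le_mul fun P Q => ?_
    rw [dist_eq_norm, dist_eq_norm]
    have : F t P - F t Q = (G.bracket (δ x)).comp (Q - P) := by
      simp only [F, ContinuousLinearMap.comp_sub]; abel
    rw [this, norm_sub_rev P Q]
    exact ContinuousLinearMap.opNorm_comp_le _ _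
  have hP : ∀ t : ℝ, HasDerivAt (fun t : ℝ => δ.comp (t • G.dLInv (t • x)))
      (F t (δ.comp (t • G.dLInv (t • x)))) t := fun t => by
    have h := (hasDerivAt_const t δ).clm_comp (G.hasDerivAt_smul_dLInv x t)
    refine h.congr_deriv ?_
    ext1 z
    simp [F, hδ, G.dil_bracket]
  have hQ : ∀ t : ℝ, HasDerivAt (fun t : ℝ => (t • G.dLInv (t • δ x)).comp δ)
      (F t ((t • G.dLInv (t • δ x)).comp δ)) t := fun t => by
    have h := (G.hasDerivAt_smul_dLInv (δ x) t).clm_comp (hasDerivAt_const t δ)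
    refine h.congr_deriv ?_
    ext1 z
    simp [F]
  have h := ODE_solution_unique_univ (v := F) (s := fun _ => Set.univ) (t₀ := 0)
    (fun t => (hF t).lipschitzOnWith) (fun t => ⟨hP t, trivial⟩) (fun t => ⟨hQ t, trivial⟩)
    (by simp)
  simpa using congrFun h 1

/-- Dilations are automorphisms at the level of left invariant fields: they push the field with
value `v` at the identity to the one with value `δ_r v`. -/
theorem dil_dL (r : ℝ) (x v : Fin N → ℝ) : G.dil r (G.dL x v) = G.dL (G.dil r x) (G.dil r v) := by
  have h := congrArg (fun A => G.dL (G.dil r x) (A (G.dL x v))) (G.dil_comp_dLInv r x)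
  simpa [G.dL_dLInv, G.dLInv_dL] using h.symm

end CarnotGroup

/-! ### Absolutely continuous curves -/

section AbsolutelyContinuous

theorem AbsolutelyContinuousOnInterval.pi {ι : Type*} [Fintype ι] {γ : ℝ → ι → ℝ} {a b : ℝ}
    (h : ∀ i, AbsolutelyContinuousOnInterval (fun t => γ t i) a b) :
    AbsolutelyContinuousOnInterval γ a b := by
  refine squeeze_zero (fun E => Finset.sum_nonneg fun _ _ => dist_nonneg) (fun E => ?_)
    (by simpa using tendsto_finsetSum Finset.univ fun i _ => h i)
  rw [Finset.sum_comm]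
  refine Finset.sum_le_sum fun k _ =>
    (dist_pi_le_iff (Finset.sum_nonneg fun _ _ => dist_nonneg)).2 fun i => ?_
  exact Finset.single_le_sum (f := fun i => dist (γ (E.2 k).1 i) (γ (E.2 k).2 i))
    (fun _ _ => dist_nonneg) (Finset.mem_univ i)

theorem AbsolutelyContinuousOnInterval.of_dist_le {X Y : Type*} [PseudoMetricSpace X]
    [PseudoMetricSpace Y] {f : ℝ → X} {g : ℝ → Y} {a b K : ℝ}
    (hf : AbsolutelyContinuousOnInterval f a b)
    (h : ∀ s ∈ Set.uIcc a b, ∀ t ∈ Set.uIcc a b, dist (g s) (g t) ≤ K * dist (f s) (f t)) :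
    AbsolutelyContinuousOnInterval g a b := by
  have hK := Tendsto.const_mul K hf
  rw [mul_zero] at hK
  refine squeeze_zero' (Eventually.of_forall fun E => Finset.sum_nonneg fun _ _ => dist_nonneg)
    ?_ hK
  refine Eventually.filter_mono inf_le_right (mem_principal.2 ?_)
  intro E hE
  rw [Set.mem_ofPred_eq, Finset.mul_sum]
  exact Finset.sum_le_sum fun i hi => h _ (hE.1 i hi).1 _ (hE.1 i hi).2

theorem ae_hasDerivAt_of_eq_integral {E : Type*} [NormedAddCommGroup E] [NormedSpace ℝ E]
    [CompleteSpace E] {γ w : ℝ → E} {a b : ℝ} (hab : a ≤ b)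
    (hw : IntervalIntegrable w volume a b)
    (h : ∀ t ∈ Set.uIcc a b, γ t = γ a + ∫ τ in a..t, w τ) :
    ∀ᵐ t, t ∈ Set.Icc a b → HasDerivAt γ (w t) t := by
  have ha : ∀ᵐ t : ℝ, t ≠ a := by simp [ae_iff, measure_singleton]
  have hb : ∀ᵐ t : ℝ, t ≠ b := by simp [ae_iff, measure_singleton]
  rw [Set.uIcc_of_le hab] at h
  filter_upwards [hw.ae_hasDerivAt_integral, ha, hb] with t ht hta htb htm
  rw [Set.uIcc_of_le hab] at ht
  refine ((ht htm a (Set.left_mem_Icc.2 hab)).const_add (γ a)).congr_of_eventuallyEq ?_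
  filter_upwards [Icc_mem_nhds (lt_of_le_of_ne htm.1 hta.symm) (lt_of_le_of_ne htm.2 htb)]
    with τ hτ using h τ hτ

theorem absolutelyContinuousOnInterval_of_eq_integral {ι : Type*} [Fintype ι] {γ w : ℝ → ι → ℝ}
    {a b : ℝ} (hw : IntervalIntegrable w volume a b)
    (h : ∀ t ∈ Set.uIcc a b, γ t = γ a + ∫ τ in a..t, w τ) :
    AbsolutelyContinuousOnInterval γ a b := by
  refine AbsolutelyContinuousOnInterval.pi fun i => ?_
  have hwi : IntervalIntegrable (fun t => w t i) volume a b :=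
    ⟨hw.1.eval i, hw.2.eval i⟩
  refine (hwi.absolutelyContinuousOnInterval_intervalIntegral Set.left_mem_uIcc).of_dist_le
    (K := 1) fun s hs t ht => le_of_eq ?_
  have hcoord : ∀ t ∈ Set.uIcc a b, γ t i = γ a i + ∫ τ in a..t, w τ i := by
    intro t ht
    have hsub : IntervalIntegrable w volume a t :=
      hw.mono_set (Set.uIcc_subset_uIcc Set.left_mem_uIcc ht)
    have h1 := (ContinuousLinearMap.proj (R := ℝ) (φ := fun _ : ι => ℝ) i).intervalIntegral_comp_comm
      hsub
    simp only [ContinuousLinearMap.proj_apply] at h1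
    rw [h1]
    exact congrFun (h t ht) i
  rw [hcoord s hs, hcoord t ht, dist_add_left, one_mul]

/-- The fundamental theorem of calculus for an absolutely continuous curve in `ℝ^N`. -/
theorem AbsolutelyContinuousOnInterval.eq_integral {ι : Type*} [Fintype ι] {γ w : ℝ → ι → ℝ}
    {a b : ℝ} (hab : a ≤ b) (hγ : AbsolutelyContinuousOnInterval γ a b)
    (hw : IntervalIntegrable w volume a b)
    (hd : ∀ᵐ t, t ∈ Set.Icc a b → HasDerivAt γ (w t) t) :
    ∀ t ∈ Set.uIcc a b, γ t = γ a + ∫ τ in a..t, w τ := by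
  have hI : ∀ t ∈ Set.uIcc a b, (∫ τ in a..t, w τ) = (∫ τ in a..a, w τ) + ∫ τ in a..t, w τ := by
    simp
  have h0 : AbsolutelyContinuousOnInterval (fun t => γ t - ∫ τ in a..t, w τ) a b :=
    hγ.sub (absolutelyContinuousOnInterval_of_eq_integral hw hI)
  obtain ⟨C, hC⟩ := h0.const_of_ae_hasDerivAt_zero (by
    rw [Set.uIcc_of_le hab]
    filter_upwards [hd, ae_hasDerivAt_of_eq_integral hab hw hI] with t h1 h2 ht
    exact ((h1 ht).sub (h2 ht)).congr_deriv (sub_self _))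
  intro t ht
  have h1 := hC t ht
  have h2 := hC a Set.left_mem_uIcc
  simp only [intervalIntegral.integral_same, sub_zero] at h2
  rw [h2, ← h1, sub_add_cancel]

end AbsolutelyContinuous

namespace CarnotGroup

variable {N s : ℕ} (G : CarnotGroup N s)

/-! ### Horizontal curves -/

/-- The horizontal velocity `∑ u_j X_j(γ)`. -/
noncomputable def velocity (γ : ℝ → Fin N → ℝ) (u : {i : Fin N // G.deg i = 1} → ℝ → ℝ) (t : ℝ) :
    Fin N → ℝ :=
  ∑ j, u j t • G.X j (γ t)

/-- The integral form of the equation `γ' = ∑ u_j X_j(γ)` between `a` and `b`, in either order. -/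
structure IsControlled (γ : ℝ → Fin N → ℝ) (u : {i : Fin N // G.deg i = 1} → ℝ → ℝ)
    (a b : ℝ) : Prop where
  integrable : ∀ j, IntervalIntegrable (u j) volume a b
  continuousOn : ContinuousOn γ (Set.uIcc a b)
  eq_integral : ∀ t ∈ Set.uIcc a b, γ t = γ a + ∫ τ in a..t, G.velocity γ u τ

variable {G}
variable {γ : ℝ → Fin N → ℝ} {u : {i : Fin N // G.deg i = 1} → ℝ → ℝ} {a b : ℝ}

theorem intervalIntegrable_velocity (hu : ∀ j, IntervalIntegrable (u j) volume a b)
    (hγ : ContinuousOn γ (Set.uIcc a b)) : IntervalIntegrable (G.velocity γ u) volume a b := by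
  have h : G.velocity γ u = ∑ j, fun t => u j t • G.X j (γ t) := by
    funext t; simp [velocity]
  rw [h]
  exact IntervalIntegrable.sum _ fun j _ => (hu j).smul_continuousOn
    ((G.contDiff_leftField _).continuous.comp_continuousOn hγ)

theorem IsControlled.intervalIntegrable (h : G.IsControlled γ u a b) :
    IntervalIntegrable (G.velocity γ u) volume a b :=
  intervalIntegrable_velocity h.integrable h.continuousOn

theorem IsControlled.sub_eq (h : G.IsControlled γ u a b) {t₁ t₂ : ℝ} (h₁ : t₁ ∈ Set.uIcc a b)
    (h₂ : t₂ ∈ Set.uIcc a b) : γ t₂ - γ t₁ = ∫ τ in t₁..t₂, G.velocity γ u τ := by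
  rw [h.eq_integral _ h₁, h.eq_integral _ h₂, add_sub_add_left_eq_sub,
    intervalIntegral.integral_interval_sub_left]
  · exact h.intervalIntegrable.mono_set (Set.uIcc_subset_uIcc Set.left_mem_uIcc h₂)
  · exact h.intervalIntegrable.mono_set (Set.uIcc_subset_uIcc Set.left_mem_uIcc h₁)

theorem IsControlled.symm (h : G.IsControlled γ u a b) : G.IsControlled γ u b a where
  integrable j := (h.integrable j).symm
  continuousOn := by rw [Set.uIcc_comm]; exact h.continuousOn
  eq_integral t ht := by
    rw [Set.uIcc_comm] at ht
    rw [← h.sub_eq Set.right_mem_uIcc ht, add_sub_cancel]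

theorem IsControlled.ae_hasDerivAt (hab : a ≤ b) (h : G.IsControlled γ u a b) :
    ∀ᵐ t, t ∈ Set.Icc a b → HasDerivAt γ (G.velocity γ u t) t :=
  ae_hasDerivAt_of_eq_integral hab h.intervalIntegrable h.eq_integral

theorem IsControlled.absolutelyContinuousOnInterval (h : G.IsControlled γ u a b) :
    AbsolutelyContinuousOnInterval γ a b :=
  absolutelyContinuousOnInterval_of_eq_integral h.intervalIntegrable h.eq_integral

theorem isHorizontal_iff (hab : a ≤ b) : G.IsHorizontal γ u a b ↔ G.IsControlled γ u a b := by
  constructor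
  · rintro ⟨⟨-, h2, h3⟩, h4, h5⟩
    have hd : IntervalIntegrable (deriv γ) volume a b :=
      (intervalIntegrable_iff_integrableOn_Icc_of_le hab).2 h2
    have h3' : ∀ t ∈ Set.uIcc a b, γ t = γ a + ∫ τ in a..t, deriv γ τ := by
      intro t ht
      rw [Set.uIcc_of_le hab] at ht
      rw [← h3 a (Set.left_mem_Icc.2 hab) t ht, add_sub_cancel]
    refine ⟨fun j => (intervalIntegrable_iff_integrableOn_Icc_of_le hab).2 (h4 j),
      (absolutelyContinuousOnInterval_of_eq_integral hd h3').continuousOn, fun t ht => ?_⟩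
    rw [h3' t ht]
    congr 1
    refine intervalIntegral.integral_congr_ae ?_
    rw [ae_restrict_iff' measurableSet_Icc] at h5
    filter_upwards [h5] with τ hτ hmem
    rw [Set.uIcc_of_le hab] at ht
    rw [Set.uIoc_of_le ht.1] at hmem
    exact hτ ⟨hmem.1.le, hmem.2.trans ht.2⟩
  · intro h
    have hae := h.ae_hasDerivAt hab
    have hae' : ∀ᵐ t ∂volume.restrict (Set.Icc a b), deriv γ t = G.velocity γ u t := by
      rw [ae_restrict_iff' measurableSet_Icc]
      filter_upwards [hae] with t ht hm using (ht hm).deriv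
    refine ⟨⟨?_, ?_, fun t₁ h₁ t₂ h₂ => ?_⟩,
      fun j => (intervalIntegrable_iff_integrableOn_Icc_of_le hab).1 (h.integrable j), hae'⟩
    · rw [ae_restrict_iff' measurableSet_Icc]
      filter_upwards [hae] with t ht hm using (ht hm).differentiableAt
    · exact ((intervalIntegrable_iff_integrableOn_Icc_of_le hab).1
        h.intervalIntegrable).congr (EventuallyEq.symm hae')
    · rw [h.sub_eq (Set.Icc_subset_uIcc h₁) (Set.Icc_subset_uIcc h₂)]
      refine intervalIntegral.integral_congr_ae ?_
      rw [ae_restrict_iff' measurableSet_Icc] at hae'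
      filter_upwards [hae'] with τ hτ hm
      exact (hτ (Set.ordConnected_Icc.uIcc_subset h₁ h₂ (Set.uIoc_subset_uIcc hm))).symm

theorem IsControlled.mul_left (hab : a ≤ b) (h : G.IsControlled γ u a b) (z : Fin N → ℝ) :
    G.IsControlled (fun t => G.mul z (γ t)) u a b := by
  have hcont : ContinuousOn (fun t => G.mul z (γ t)) (Set.uIcc a b) :=
    (G.contDiff_mul_left z).continuous.comp_continuousOn h.continuousOn
  refine ⟨h.integrable, hcont, ?_⟩
  refine AbsolutelyContinuousOnInterval.eq_integral hab ?_
    (intervalIntegrable_velocity h.integrable hcont) ?_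
  · have hlip : LocallyLipschitz (G.mul z) :=
      ((G.contDiff_mul_left z).of_le (by simp)).locallyLipschitz
    obtain ⟨K, hK⟩ := hlip.locallyLipschitzOn.exists_lipschitzOnWith_of_compact
      (isCompact_uIcc.image_of_continuousOn h.continuousOn)
    exact h.absolutelyContinuousOnInterval.of_dist_le (K := K) fun s hs t ht =>
      hK.dist_le_mul _ (Set.mem_image_of_mem _ hs) _ (Set.mem_image_of_mem _ ht)
  · filter_upwards [h.ae_hasDerivAt hab] with t ht hm
    have h1 := HasFDerivAt.comp_hasDerivAt (f := γ) t
      (G.differentiable_mul_left z (γ t)).hasFDerivAt (ht hm)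
    refine h1.congr_deriv ?_
    simp only [velocity, map_sum, map_smul]
    exact Finset.sum_congr rfl fun j _ => congrArg _ (G.fderiv_mul_left_dL _ _ _)

theorem IsControlled.dil (h : G.IsControlled γ u a b) (r : ℝ) :
    G.IsControlled (fun t => G.dil r (γ t)) (fun j t => r * u j t) a b := by
  refine ⟨fun j => (h.integrable j).const_mul r, (G.dil r).continuous.comp_continuousOn
    h.continuousOn, fun t ht => ?_⟩
  have hsub : IntervalIntegrable (G.velocity γ u) volume a t :=
    h.intervalIntegrable.mono_set (Set.uIcc_subset_uIcc Set.left_mem_uIcc ht)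
  rw [h.eq_integral t ht, map_add, ← (G.dil r).intervalIntegral_comp_comm hsub]
  congr 2
  funext τ
  simp only [velocity, map_sum, map_smul]
  refine Finset.sum_congr rfl fun j _ => ?_
  have hj : Pi.single (j : Fin N) (1 : ℝ) ∈ G.layer 1 := by
    have := G.single_mem_layer j 1
    rwa [j.2] at this
  have h1 : G.dil r (G.X j (γ τ)) = r • G.X j (G.dil r (γ τ)) := by
    simp only [X, G.leftField_apply, G.dil_dL, G.dil_of_mem_layer hj, pow_one, map_smul]
  rw [h1, smul_smul, mul_comm]

/-- Affine change of parameter. -/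
theorem IsControlled.comp_affine {c d : ℝ} (hc : c ≠ 0)
    (h : G.IsControlled γ u (c * a + d) (c * b + d)) :
    G.IsControlled (fun t => γ (c * t + d)) (fun j t => c * u j (c * t + d)) a b := by
  have hmem : ∀ t ∈ Set.uIcc a b, c * t + d ∈ Set.uIcc (c * a + d) (c * b + d) := by
    intro t ht
    have h1 : (fun x => c * x + d) '' Set.uIcc a b = Set.uIcc (c * a + d) (c * b + d) := by
      rw [← Set.image_image (fun x => x + d) (fun x => c * x), Set.image_const_mul_uIcc,
        Set.image_add_const_uIcc]
    rw [← h1]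
    exact Set.mem_image_of_mem _ ht
  refine ⟨fun j => ?_, h.continuousOn.comp (by fun_prop) hmem, fun t ht => ?_⟩
  · have h1 := ((h.integrable j).comp_add_right d).comp_mul_left (c := c)
    simp only [add_sub_cancel_right, mul_div_cancel_left₀ _ hc] at h1
    exact h1.const_mul c
  · rw [h.eq_integral _ (hmem t ht), ← intervalIntegral.smul_integral_comp_mul_add,
      ← intervalIntegral.integral_smul]
    congr 2
    funext τ
    simp only [velocity, Finset.smul_sum, smul_smul]

/-- Concatenation of controlled curves. -/
theorem IsControlled.glue {γ' : ℝ → Fin N → ℝ} {u' : {i : Fin N // G.deg i = 1} → ℝ → ℝ} {c : ℝ}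
    (hab : a ≤ b) (hbc : b ≤ c) (h : G.IsControlled γ u a b) (h' : G.IsControlled γ' u' b c)
    (hb : γ b = γ' b) :
    G.IsControlled (fun t => if t ≤ b then γ t else γ' t)
      (fun j t => if t ≤ b then u j t else u' j t) a c := by
  set Γ : ℝ → Fin N → ℝ := fun t => if t ≤ b then γ t else γ' t with hΓ
  set U : {i : Fin N // G.deg i = 1} → ℝ → ℝ := fun j t => if t ≤ b then u j t else u' j t with hU
  have hv1 : Set.EqOn (G.velocity γ u) (G.velocity Γ U) (Set.uIoc a b) := by
    intro t ht
    rw [Set.uIoc_of_le hab] at ht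
    simp only [velocity, hΓ, hU, if_pos ht.2]
  have hv2 : Set.EqOn (G.velocity γ' u') (G.velocity Γ U) (Set.uIoc b c) := by
    intro t ht
    rw [Set.uIoc_of_le hbc] at ht
    simp only [velocity, hΓ, hU, if_neg ht.1.not_ge]
  have hΓ1 : ∀ t, t ≤ b → Γ t = γ t := fun t ht => if_pos ht
  have hΓ2 : ∀ t, b ≤ t → Γ t = γ' t := by
    intro t ht
    rcases ht.eq_or_lt with rfl | ht
    · rw [hΓ1 _ le_rfl, hb]
    · exact if_neg ht.not_ge
  refine ⟨fun j => ?_, ?_, fun t ht => ?_⟩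
  · refine ((h.integrable j).congr fun t ht => ?_).trans ((h'.integrable j).congr fun t ht => ?_)
    · rw [Set.uIoc_of_le hab] at ht
      exact (if_pos ht.2).symm
    · rw [Set.uIoc_of_le hbc] at ht
      exact (if_neg ht.1.not_ge).symm
  · have h1 : ContinuousOn Γ (Set.Icc a b) :=
      (h.continuousOn.mono Set.Icc_subset_uIcc).congr fun t ht => hΓ1 t ht.2
    have h2 : ContinuousOn Γ (Set.Icc b c) :=
      (h'.continuousOn.mono Set.Icc_subset_uIcc).congr fun t ht => hΓ2 t ht.1
    rw [Set.uIcc_of_le (hab.trans hbc), ← Set.Icc_union_Icc_eq_Icc hab hbc]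
    exact h1.union_of_isClosed h2 isClosed_Icc isClosed_Icc
  · rw [Set.uIcc_of_le (hab.trans hbc)] at ht
    rw [hΓ1 a hab]
    rcases le_total t b with htb | htb
    · rw [hΓ1 t htb, h.eq_integral t (by rw [Set.uIcc_of_le hab]; exact ⟨ht.1, htb⟩)]
      congr 1
      refine intervalIntegral.integral_congr_ae (Eventually.of_forall fun τ hτ => hv1 ?_)
      rw [Set.uIoc_of_le ht.1] at hτ
      rw [Set.uIoc_of_le hab]
      exact ⟨hτ.1, hτ.2.trans htb⟩
    · have hsub : Set.uIoc b t ⊆ Set.uIoc b c := by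
        rw [Set.uIoc_of_le htb, Set.uIoc_of_le hbc]
        exact Set.Ioc_subset_Ioc_right ht.2
      rw [hΓ2 t htb, h'.eq_integral t (by rw [Set.uIcc_of_le hbc]; exact ⟨htb, ht.2⟩), ← hb,
        h.eq_integral b Set.right_mem_uIcc, add_assoc]
      congr 1
      rw [intervalIntegral.integral_congr_ae (Eventually.of_forall fun τ hτ => hv1 hτ),
        intervalIntegral.integral_congr_ae (Eventually.of_forall fun τ hτ => hv2 (hsub hτ))]
      refine intervalIntegral.integral_add_adjacent_intervals
        (h.intervalIntegrable.congr hv1) ?_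
      exact (h'.intervalIntegrable.mono_set (Set.uIcc_subset_uIcc Set.left_mem_uIcc
        (by rw [Set.uIcc_of_le hbc]; exact ⟨htb, ht.2⟩))).congr fun τ hτ => hv2 (hsub hτ)

/-! ### The Carnot-Caratheodory distance -/

variable (G)

/-- The lengths of the horizontal curves from `x` to `y`. -/
def lengths (x y : Fin N → ℝ) : Set ℝ :=
  {L | ∃ γ u, G.IsHorizontal γ u 0 1 ∧ γ 0 = x ∧ γ 1 = y ∧ L = G.horizontalLength u 0 1}

theorem mem_lengths {x y : Fin N → ℝ} {L : ℝ} : L ∈ G.lengths x y ↔ ∃ γ u,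
    G.IsControlled γ u 0 1 ∧ γ 0 = x ∧ γ 1 = y ∧ L = G.horizontalLength u 0 1 := by
  simp only [lengths, Set.mem_ofPred_eq, isHorizontal_iff zero_le_one]

theorem lengths_nonneg {x y : Fin N → ℝ} {L : ℝ} (h : L ∈ G.lengths x y) : 0 ≤ L := by
  obtain ⟨γ, u, -, -, -, rfl⟩ := h
  exact intervalIntegral.integral_nonneg zero_le_one fun t _ => Real.sqrt_nonneg _

theorem mul_left_mem_lengths {x y : Fin N → ℝ} {L : ℝ} (z : Fin N → ℝ) (h : L ∈ G.lengths x y) :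
    L ∈ G.lengths (G.mul z x) (G.mul z y) := by
  rw [mem_lengths] at h ⊢
  obtain ⟨γ, u, h, rfl, rfl, rfl⟩ := h
  exact ⟨_, u, h.mul_left zero_le_one z, rfl, rfl, rfl⟩

theorem dil_mem_lengths {x y : Fin N → ℝ} {L r : ℝ} (hr : 0 ≤ r) (h : L ∈ G.lengths x y) :
    r * L ∈ G.lengths (G.dil r x) (G.dil r y) := by
  rw [mem_lengths] at h ⊢
  obtain ⟨γ, u, h, rfl, rfl, rfl⟩ := h
  refine ⟨_, _, h.dil r, rfl, rfl, ?_⟩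
  rw [horizontalLength, horizontalLength, ← intervalIntegral.integral_const_mul]
  congr 1
  funext t
  rw [← Real.sqrt_sq hr, ← Real.sqrt_mul (sq_nonneg r), Finset.mul_sum, Real.sqrt_sq hr]
  simp only [mul_pow]

theorem reverse_mem_lengths {x y : Fin N → ℝ} {L : ℝ} (h : L ∈ G.lengths x y) :
    L ∈ G.lengths y x := by
  rw [mem_lengths] at h ⊢
  obtain ⟨γ, u, h, rfl, rfl, rfl⟩ := h
  refine ⟨_, _, IsControlled.comp_affine (c := -1) (d := 1) (by norm_num) (by simpa using h.symm),
    by simp, by simp, ?_⟩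
  have := intervalIntegral.smul_integral_comp_mul_add (a := 0) (b := 1)
    (fun t => Real.sqrt (∑ j, u j t ^ 2)) (-1) 1
  rw [horizontalLength, horizontalLength]
  simp at this ⊢
  rw [intervalIntegral.integral_symm 0 1] at this
  linarith

variable {G} in
theorem intervalIntegrable_speed (hu : ∀ j, IntervalIntegrable (u j) volume a b) :
    IntervalIntegrable (fun t => Real.sqrt (∑ j, u j t ^ 2)) volume a b := by
  have hsum : IntervalIntegrable (∑ j, fun t => |u j t|) volume a b :=
    IntervalIntegrable.sum _ fun j _ => (hu j).abs
  refine hsum.mono_fun' ?_ (Eventually.of_forall fun t => ?_)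
  · refine Real.continuous_sqrt.comp_aestronglyMeasurable ?_
    refine Finset.aestronglyMeasurable_fun_sum _ fun j _ => ?_
    exact (intervalIntegrable_iff.1 (hu j)).aestronglyMeasurable.pow 2
  · simp only [Finset.sum_apply]
    rw [Real.norm_of_nonneg (Real.sqrt_nonneg _)]
    refine Real.sqrt_le_iff.2 ⟨Finset.sum_nonneg fun _ _ => abs_nonneg _, ?_⟩
    simpa only [sq_abs] using Finset.sum_sq_le_sq_sum_of_nonneg
      (s := Finset.univ) (f := fun j => |u j t|) fun _ _ => abs_nonneg _

theorem add_mem_lengths {x y z : Fin N → ℝ} {L L' : ℝ} (h : L ∈ G.lengths x y)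
    (h' : L' ∈ G.lengths y z) : L + L' ∈ G.lengths x z := by
  rw [mem_lengths] at h h' ⊢
  obtain ⟨γ, u, h, rfl, rfl, rfl⟩ := h
  obtain ⟨γ', u', h', hy, rfl, rfl⟩ := h'
  have k := IsControlled.comp_affine (a := 0) (b := 1 / 2) (c := 2) (d := 0) (by norm_num)
    (by norm_num; exact h)
  have k' := IsControlled.comp_affine (a := 1 / 2) (b := 1) (c := 2) (d := -1) (by norm_num)
    (by norm_num; exact h')
  have hg := k.glue (by norm_num) (by norm_num) k' (by norm_num [hy])
  refine ⟨_, _, hg, by norm_num, by norm_num, ?_⟩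
  have i1 := intervalIntegrable_speed (fun j => hg.integrable j)
  have hint (v : {i : Fin N // G.deg i = 1} → ℝ → ℝ) (a b d : ℝ)
      (ha : 2 * a + d = 0) (hb : 2 * b + d = 1) :
      G.horizontalLength v 0 1 =
        ∫ t in a..b, Real.sqrt (∑ j, (2 * v j (2 * t + d)) ^ 2) := by
    rw [horizontalLength, ← ha, ← hb, ← intervalIntegral.smul_integral_comp_mul_add,
      ← intervalIntegral.integral_smul]
    congr 1
    funext t
    simp only [mul_pow, ← Finset.mul_sum]
    rw [Real.sqrt_mul (by norm_num), Real.sqrt_sq (by norm_num), smul_eq_mul]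
  rw [hint u 0 (1 / 2) 0 (by norm_num) (by norm_num),
    hint u' (1 / 2) 1 (-1) (by norm_num) (by norm_num), horizontalLength]
  have hm : (1 / 2 : ℝ) ∈ Set.uIcc (0 : ℝ) 1 := by
    rw [Set.uIcc_of_le zero_le_one]; constructor <;> norm_num
  rw [← intervalIntegral.integral_add_adjacent_intervals
    (i1.mono_set (Set.uIcc_subset_uIcc Set.left_mem_uIcc hm))
    (i1.mono_set (Set.uIcc_subset_uIcc hm Set.right_mem_uIcc))]
  congr 1
  · refine intervalIntegral.integral_congr_ae (Eventually.of_forall fun t ht => ?_)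
    rw [Set.uIoc_of_le (by norm_num)] at ht
    simp only [if_pos ht.2]
  · refine intervalIntegral.integral_congr_ae (Eventually.of_forall fun t ht => ?_)
    rw [Set.uIoc_of_le (by norm_num)] at ht
    simp only [if_neg ht.1.not_ge]

/-- The segment from `0` to a vector of the first layer is a horizontal curve. -/
theorem sqrt_mem_lengths_zero {v : Fin N → ℝ} (hv : v ∈ G.layer 1) :
    Real.sqrt (∑ j : {i : Fin N // G.deg i = 1}, v j ^ 2) ∈ G.lengths 0 v := by
  rw [mem_lengths]
  have hvel : G.velocity (fun t => t • v) (fun j _ => v j) = fun _ => v := by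
    funext t
    have h1 : ∑ j : {i : Fin N // G.deg i = 1}, v j • Pi.single (j : Fin N) (1 : ℝ) = v := by
      ext i
      rw [Finset.sum_apply]
      by_cases hi : G.deg i = 1
      · rw [Finset.sum_eq_single ⟨i, hi⟩]
        · simp
        · rintro j - hj
          have : i ≠ j := fun h => hj (Subtype.ext h.symm)
          simp [this]
        · simp
      · rw [hv i hi]
        refine Finset.sum_eq_zero fun j _ => ?_
        have : i ≠ j := fun h => hi (h ▸ j.2)
        simp [this]
    have h2 : G.dL (t • v) v = v := by
      rcases eq_or_ne t 0 with rfl | ht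
      · rw [zero_smul, G.dL_zero]; rfl
      · have := G.dL_self (t • v)
        rw [map_smul] at this
        exact smul_right_injective _ ht this
    calc G.velocity (fun t => t • v) (fun j _ => v j) t
        = G.dL (t • v) (∑ j : {i : Fin N // G.deg i = 1}, v j • Pi.single (j : Fin N) (1 : ℝ)) := by
          simp only [velocity, map_sum, map_smul, X, G.leftField_apply]
      _ = v := by rw [h1, h2]
  refine ⟨fun t => t • v, fun j _ => v j, ⟨fun j => intervalIntegrable_const,
    (continuous_id.smul continuous_const).continuousOn, fun t ht => ?_⟩, by simp, by simp, ?_⟩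
  · rw [hvel]; simp
  · simp [horizontalLength]

theorem ccDist_eq (x y : Fin N → ℝ) : G.ccDist x y = sInf (G.lengths x y) := rfl

theorem bddBelow_lengths (x y : Fin N → ℝ) : BddBelow (G.lengths x y) :=
  ⟨0, fun _ h => G.lengths_nonneg h⟩

theorem ccDist_nonneg (x y : Fin N → ℝ) : 0 ≤ G.ccDist x y :=
  Real.sInf_nonneg fun _ h => G.lengths_nonneg h

theorem ccDist_mul_left (z x y : Fin N → ℝ) : G.ccDist (G.mul z x) (G.mul z y) = G.ccDist x y := by
  have : G.lengths (G.mul z x) (G.mul z y) = G.lengths x y := by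
    refine Set.Subset.antisymm (fun L h => ?_) fun L h => G.mul_left_mem_lengths z h
    have := G.mul_left_mem_lengths (-z) h
    rwa [G.neg_mul_cancel_left, G.neg_mul_cancel_left] at this
  rw [ccDist_eq, ccDist_eq, this]

theorem ccDist_comm (x y : Fin N → ℝ) : G.ccDist x y = G.ccDist y x := by
  rw [ccDist_eq, ccDist_eq]
  exact congrArg sInf (Set.Subset.antisymm (fun _ => G.reverse_mem_lengths)
    fun _ => G.reverse_mem_lengths)

open scoped Pointwise in
theorem ccDist_dil {r : ℝ} (hr : 0 < r) (x y : Fin N → ℝ) :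
    G.ccDist (G.dil r x) (G.dil r y) = r * G.ccDist x y := by
  have : G.lengths (G.dil r x) (G.dil r y) = r • G.lengths x y := by
    refine Set.Subset.antisymm (fun L h => ?_) ?_
    · have := G.dil_mem_lengths (inv_nonneg.2 hr.le) h
      rw [G.dil_inv_dil hr.ne', G.dil_inv_dil hr.ne'] at this
      exact ⟨_, this, by simp [hr.ne']⟩
    · rintro _ ⟨L, h, rfl⟩
      exact G.dil_mem_lengths hr.le h
  rw [ccDist_eq, ccDist_eq, this, Real.sInf_smul_of_nonneg hr.le, smul_eq_mul]

/-! ### The adjoint action and its derivative -/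

/-- Conjugation by `h`. -/
def conj (h z : Fin N → ℝ) : Fin N → ℝ := G.mul (G.mul h z) (-h)

/-- The adjoint action: the differential at the identity of conjugation by `h`. -/
noncomputable def Ad (h : Fin N → ℝ) : (Fin N → ℝ) →L[ℝ] (Fin N → ℝ) := fderiv ℝ (G.conj h) 0

theorem conj_zero (h : Fin N → ℝ) : G.conj h 0 = 0 := by
  rw [conj, G.mul_zero, G.mul_neg_self]

theorem contDiff_conj :
    ContDiff ℝ ∞ fun p : (Fin N → ℝ) × (Fin N → ℝ) => G.conj p.1 p.2 :=
  G.contDiff_mul.comp (G.contDiff_mul.prodMk (contDiff_neg.comp contDiff_fst))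

theorem contDiff_conj_right (h : Fin N → ℝ) : ContDiff ℝ ∞ (G.conj h) :=
  G.contDiff_conj.comp (contDiff_const.prodMk contDiff_id)

theorem differentiable_Ad : Differentiable ℝ G.Ad :=
  (ContDiff.fderiv (m := ∞) (n := ∞) (f := G.conj) G.contDiff_conj contDiff_const
    (by simp)).differentiable (by simp)

theorem Ad_zero : G.Ad 0 = .id ℝ _ := by
  have : G.conj 0 = id := by
    funext z
    rw [conj, G.zero_mul, neg_zero, G.mul_zero, id]
  rw [Ad, this, fderiv_id]

theorem Ad_mul (g h v : Fin N → ℝ) : G.Ad (G.mul g h) v = G.Ad g (G.Ad h v) := by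
  have h1 : G.conj (G.mul g h) = G.conj g ∘ G.conj h := by
    funext z
    simp only [conj, Function.comp_apply, G.neg_mul_rev, G.mul_assoc]
  have h2 := fderiv_comp (0 : Fin N → ℝ)
    ((G.contDiff_conj_right g).differentiable (by simp) (G.conj h 0))
    ((G.contDiff_conj_right h).differentiable (by simp) 0)
  rw [Ad, h1, h2, G.conj_zero]
  rfl

/-- The differential at the identity of right translation by `x`. -/
noncomputable def dR (x : Fin N → ℝ) : (Fin N → ℝ) →L[ℝ] (Fin N → ℝ) :=
  fderiv ℝ (fun y => G.mul y x) 0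

theorem differentiable_dR : Differentiable ℝ G.dR :=
  (ContDiff.fderiv (m := ∞) (n := ∞) (f := fun x y => G.mul y x)
    (G.contDiff_mul.comp (contDiff_snd.prodMk contDiff_fst)) contDiff_const
    (by simp)).differentiable (by simp)

theorem dR_zero : G.dR 0 = .id ℝ _ := by
  have : (fun y => G.mul y 0) = id := funext G.mul_zero
  rw [dR, this, fderiv_id]

theorem dL_eq_dR_Ad (x w : Fin N → ℝ) : G.dL x w = G.dR x (G.Ad x w) := by
  have h1 : G.mul x = (fun y => G.mul y x) ∘ G.conj x := by
    funext z
    rw [Function.comp_apply, conj, G.mul_assoc, G.neg_mul_self, G.mul_zero]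
  have h2 := fderiv_comp (0 : Fin N → ℝ)
    ((G.contDiff_mul_right x).differentiable (by simp) (G.conj x 0))
    ((G.contDiff_conj_right x).differentiable (by simp) 0)
  rw [← h1, G.conj_zero] at h2
  rw [dL, h2]
  rfl

theorem fderiv_mul_right_dir (x y w : Fin N → ℝ) :
    fderiv ℝ (fun p : (Fin N → ℝ) × (Fin N → ℝ) => G.mul p.1 p.2) (x, y) (0, w) =
      fderiv ℝ (G.mul x) y w := by
  have h := HasFDerivAt.comp (f := fun z : Fin N → ℝ => (x, z)) y
    (G.contDiff_mul.differentiable (by simp) (x, y)).hasFDerivAt (hasFDerivAt_prodMk_right x y)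
  have h2 : (fun p : (Fin N → ℝ) × (Fin N → ℝ) => G.mul p.1 p.2) ∘ (fun z => (x, z)) = G.mul x :=
    rfl
  rw [h2] at h
  rw [h.fderiv]
  rfl

theorem fderiv_mul_left_dir (x y w : Fin N → ℝ) :
    fderiv ℝ (fun p : (Fin N → ℝ) × (Fin N → ℝ) => G.mul p.1 p.2) (x, y) (w, 0) =
      fderiv ℝ (fun z => G.mul z y) x w := by
  have h := HasFDerivAt.comp (f := fun z : Fin N → ℝ => (z, y)) x
    (G.contDiff_mul.differentiable (by simp) (x, y)).hasFDerivAt (hasFDerivAt_prodMk_left x y)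
  have h2 : (fun p : (Fin N → ℝ) × (Fin N → ℝ) => G.mul p.1 p.2) ∘ (fun z => (z, y)) =
    fun z => G.mul z y := rfl
  rw [h2] at h
  rw [h.fderiv]
  rfl

/-- Equality of the mixed second derivatives of the product at the identity. -/
theorem fderiv_dR_eq (v w : Fin N → ℝ) : fderiv ℝ G.dR 0 v w = fderiv ℝ G.dL 0 w v := by
  set M : (Fin N → ℝ) × (Fin N → ℝ) → (Fin N → ℝ) := fun p => G.mul p.1 p.2 with hM
  have hsymm : IsSymmSndFDerivAt ℝ M (0, 0) :=
    (G.contDiff_mul.contDiffAt).isSymmSndFDerivAt minSmoothness_two_le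
  have hdM : HasFDerivAt (fderiv ℝ M) (fderiv ℝ (fderiv ℝ M) (0, 0)) (0, 0) :=
    ((ContDiff.fderiv_right (m := ∞) G.contDiff_mul (by simp)).differentiable
      (by simp) _).hasFDerivAt
  have hL : (fun x => G.dL x v) = fun x => fderiv ℝ M (x, 0) (0, v) :=
    funext fun x => (G.fderiv_mul_right_dir x 0 v).symm
  have hR : (fun x => G.dR x w) = fun x => fderiv ℝ M (0, x) (w, 0) :=
    funext fun x => (G.fderiv_mul_left_dir 0 x w).symm
  have h1 : fderiv ℝ (fun x => G.dL x v) 0 w = fderiv ℝ G.dL 0 w v := by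
    rw [((G.differentiable_dL 0).hasFDerivAt.clm_apply (hasFDerivAt_const v 0)).fderiv]
    simp
  have h2 : fderiv ℝ (fun x => G.dR x w) 0 v = fderiv ℝ G.dR 0 v w := by
    rw [((G.differentiable_dR 0).hasFDerivAt.clm_apply (hasFDerivAt_const w 0)).fderiv]
    simp
  have h3 := (hdM.comp (f := fun z : Fin N → ℝ => (z, (0 : Fin N → ℝ))) 0
    (hasFDerivAt_prodMk_left 0 0)).clm_apply (hasFDerivAt_const ((0 : Fin N → ℝ), v) 0)
  have h4 := (hdM.comp (f := fun z : Fin N → ℝ => ((0 : Fin N → ℝ), z)) 0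
    (hasFDerivAt_prodMk_right 0 0)).clm_apply (hasFDerivAt_const (w, (0 : Fin N → ℝ)) 0)
  rw [← h1, ← h2, hL, hR]
  have h3' : fderiv ℝ (fun x => fderiv ℝ M (x, 0) (0, v)) 0 w =
      fderiv ℝ (fderiv ℝ M) (0, 0) (w, 0) (0, v) := by
    rw [HasFDerivAt.fderiv (f := fun x => fderiv ℝ M (x, 0) (0, v)) h3]
    simp
  have h4' : fderiv ℝ (fun x => fderiv ℝ M (0, x) (w, 0)) 0 v =
      fderiv ℝ (fderiv ℝ M) (0, 0) (0, v) (w, 0) := by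
    rw [HasFDerivAt.fderiv (f := fun x => fderiv ℝ M (0, x) (w, 0)) h4]
    simp
  rw [h3', h4', hsymm.eq]

/-- The derivative of the adjoint action is the bracket. -/
theorem fderiv_Ad (v w : Fin N → ℝ) : fderiv ℝ G.Ad 0 v w = G.bracket v w := by
  have h1 := (G.differentiable_dL 0).hasFDerivAt.clm_apply (hasFDerivAt_const w (0 : Fin N → ℝ))
  have h2 := (G.differentiable_dR 0).hasFDerivAt.clm_apply
    ((G.differentiable_Ad 0).hasFDerivAt.clm_apply (hasFDerivAt_const w (0 : Fin N → ℝ)))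
  have h3 : (fun x => G.dL x w) = fun x => G.dR x (G.Ad x w) :=
    funext fun x => G.dL_eq_dR_Ad x w
  rw [h3] at h1
  have h4 := congrArg (fun A => A v) (h1.unique h2)
  simp [G.dR_zero, G.Ad_zero, G.fderiv_dR_eq] at h4
  simp only [bracket, _root_.sub_apply, ContinuousLinearMap.flip_apply]
  rw [h4, add_sub_cancel_right]

/-! ### Connectivity by horizontal curves -/

theorem add_mem_lengths_mul {x y : Fin N → ℝ} {L L' : ℝ} (h : L ∈ G.lengths 0 x)
    (h' : L' ∈ G.lengths 0 y) : L + L' ∈ G.lengths 0 (G.mul x y) := by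
  have := G.mul_left_mem_lengths x h'
  rw [G.mul_zero] at this
  exact G.add_mem_lengths h this

theorem mem_lengths_neg {x : Fin N → ℝ} {L : ℝ} (h : L ∈ G.lengths 0 x) :
    L ∈ G.lengths 0 (-x) := by
  have := G.mul_left_mem_lengths (-x) h
  rw [G.mul_zero, G.neg_mul_self] at this
  exact G.reverse_mem_lengths this

/-- The conjugates of the horizontal directions by the points which horizontal curves reach. -/
def reachableDirections : Set (Fin N → ℝ) :=
  {w | ∃ h v, (G.lengths 0 h).Nonempty ∧ v ∈ G.layer 1 ∧ w = G.Ad h v}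

/-- The span of the reachable directions is invariant under the adjoint action of the points
reached, in particular of `exp (t v)` for horizontal `v`; hence it is invariant under brackets with
horizontal vectors, and it is everything because the first layer generates the Lie algebra. -/
theorem span_reachableDirections : Submodule.span ℝ G.reachableDirections = ⊤ := by
  have h0 : (G.lengths 0 0).Nonempty :=
    ⟨_, G.sqrt_mem_lengths_zero (Submodule.zero_mem _)⟩
  have hAd : ∀ g, (G.lengths 0 g).Nonempty → ∀ w ∈ Submodule.span ℝ G.reachableDirections,
      G.Ad g w ∈ Submodule.span ℝ G.reachableDirections := by
    rintro g ⟨L, hL⟩ w hw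
    induction hw using Submodule.span_induction with
    | mem w hw =>
      obtain ⟨h, v, ⟨L', hL'⟩, hv, rfl⟩ := hw
      rw [← G.Ad_mul]
      exact Submodule.subset_span ⟨_, v, ⟨_, G.add_mem_lengths_mul hL hL'⟩, hv, rfl⟩
    | zero => rw [map_zero]; exact Submodule.zero_mem _
    | add x y _ _ hx hy => rw [map_add]; exact Submodule.add_mem _ hx hy
    | smul c x _ hx => rw [map_smul]; exact Submodule.smul_mem _ _ hx
  refine G.eq_top_of_horizontal (fun v hv => Submodule.subset_span ⟨0, v, h0, hv, ?_⟩) ?_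
  · rw [G.Ad_zero]; rfl
  · intro v hv w hw
    have hray : HasDerivAt (fun t : ℝ => t • v) v 0 := by
      simpa using (hasDerivAt_id (0 : ℝ)).smul_const v
    have hA : HasFDerivAt G.Ad (fderiv ℝ G.Ad 0) ((0 : ℝ) • v) := by
      rw [zero_smul]; exact (G.differentiable_Ad 0).hasFDerivAt
    have hd := (HasFDerivAt.comp_hasDerivAt (f := fun t : ℝ => t • v) 0 hA hray).clm_apply
      (hasDerivAt_const (0 : ℝ) w)
    simp only [Function.comp_apply, map_zero, add_zero, G.fderiv_Ad] at hd
    rw [hasDerivAt_iff_tendsto_slope] at hd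
    refine (Submodule.closed_of_finiteDimensional _).mem_of_tendsto hd
      (Eventually.of_forall fun t => ?_)
    have hmem : ∀ t : ℝ, G.Ad (t • v) w ∈ Submodule.span ℝ G.reachableDirections := fun t =>
      hAd _ ⟨_, G.sqrt_mem_lengths_zero (Submodule.smul_mem _ t hv)⟩ w hw
    exact Submodule.smul_mem _ _ (Submodule.sub_mem _ (hmem t) (hmem 0))

theorem hasStrictFDerivAt_mul_zero :
    HasStrictFDerivAt (fun p : (Fin N → ℝ) × (Fin N → ℝ) => G.mul p.1 p.2)
      (.fst ℝ _ _ + .snd ℝ _ _) (0, 0) := by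
  have h := (G.contDiff_mul.contDiffAt (x := ((0 : Fin N → ℝ), (0 : Fin N → ℝ)))).hasStrictFDerivAt
    (by simp)
  refine h.congr_fderiv (ContinuousLinearMap.ext fun p => ?_)
  have hp : p = (p.1, 0) + (0, p.2) := by simp
  rw [hp, map_add, map_add, G.fderiv_mul_left_dir, G.fderiv_mul_right_dir]
  change G.dR 0 p.1 + G.dL 0 p.2 = _
  simp [G.dR_zero, G.dL_zero]

theorem exists_mem_lengths_conj {h v : Fin N → ℝ} (hh : (G.lengths 0 h).Nonempty)
    (hv : v ∈ G.layer 1) :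
    ∃ C, ∀ t : ℝ, |t| ≤ 1 → ∃ L ∈ G.lengths 0 (G.conj h (t • v)), L ≤ C := by
  obtain ⟨L, hL⟩ := hh
  refine ⟨L + Real.sqrt (∑ j : {i : Fin N // G.deg i = 1}, v j ^ 2) + L, fun t ht =>
    ⟨_, G.add_mem_lengths_mul (G.add_mem_lengths_mul hL (G.sqrt_mem_lengths_zero
      (Submodule.smul_mem _ t hv))) (G.mem_lengths_neg hL), ?_⟩⟩
  refine add_le_add_left (add_le_add_right (Real.sqrt_le_sqrt (Finset.sum_le_sum fun j _ => ?_)) _) _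
  simp only [Pi.smul_apply, smul_eq_mul, mul_pow]
  have : t ^ 2 ≤ 1 := by rw [← sq_abs]; exact pow_le_one₀ (abs_nonneg t) ht
  exact mul_le_of_le_one_left (sq_nonneg _) this

/-- Near the identity the points are reached by horizontal curves of bounded length: a product of
conjugates of horizontal one-parameter subgroups is a submersion at the identity. -/
theorem exists_bound_lengths_nhds : ∃ C, ∀ᶠ x in 𝓝 0, ∃ L ∈ G.lengths 0 x, L ≤ C := by
  obtain ⟨T, hT, hspan⟩ := (Submodule.fg_span_iff_fg_span_finset_subset G.reachableDirections).1
    (by rw [G.span_reachableDirections]; exact Module.Finite.fg_top)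
  rw [G.span_reachableDirections] at hspan
  choose h v hh hv hw using fun b : T => hT b.2
  -- The product of the curves `h_b exp (τ_b v_b) h_b⁻¹` over a list of indices `b`.
  let P : List T → (T → ℝ) → Fin N → ℝ := fun l τ =>
    l.foldr (fun b acc => G.mul (G.conj (h b) (τ b • v b)) acc) 0
  have hP0 : ∀ l, P l 0 = 0 := by
    intro l
    induction l with
    | nil => rfl
    | cons b l ih =>
      change G.mul (G.conj (h b) ((0 : ℝ) • v b)) (P l 0) = 0
      rw [ih, zero_smul, G.conj_zero, G.mul_zero]
  have hPd : ∀ l, HasStrictFDerivAt (P l)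
      (l.map fun b : T => (ContinuousLinearMap.proj (R := ℝ) (φ := fun _ : T => ℝ) b).smulRight
        (b : Fin N → ℝ)).sum 0 := by
    intro l
    induction l with
    | nil => exact hasStrictFDerivAt_const _ _
    | cons b l ih =>
      have h1 : HasStrictFDerivAt (fun τ : T → ℝ => τ b • v b)
          ((ContinuousLinearMap.proj (R := ℝ) (φ := fun _ : T => ℝ) b).smulRight (v b)) 0 :=
        ((ContinuousLinearMap.proj (R := ℝ) (φ := fun _ : T => ℝ) b).smulRight
          (v b)).hasStrictFDerivAt
      have h2 : HasStrictFDerivAt (G.conj (h b)) (G.Ad (h b)) ((0 : T → ℝ) b • v b) := by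
        rw [Pi.zero_apply, zero_smul]
        exact (G.contDiff_conj_right (h b)).contDiffAt.hasStrictFDerivAt (by simp)
      have h3 : HasStrictFDerivAt (fun p : (Fin N → ℝ) × (Fin N → ℝ) => G.mul p.1 p.2)
          (.fst ℝ _ _ + .snd ℝ _ _) (G.conj (h b) ((0 : T → ℝ) b • v b), P l 0) := by
        rw [hP0, Pi.zero_apply, zero_smul, G.conj_zero]
        exact G.hasStrictFDerivAt_mul_zero
      have h4 := h3.comp (f := fun τ : T → ℝ => (G.conj (h b) (τ b • v b), P l τ)) 0
        ((h2.comp 0 h1).prodMk ih)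
      refine HasStrictFDerivAt.congr_fderiv h4 ?_
      ext1 τ
      rw [List.map_cons, List.sum_cons]
      simp [← hw]
  have hPlen : ∀ l, ∃ C, ∀ τ : T → ℝ, ‖τ‖ ≤ 1 → ∃ L ∈ G.lengths 0 (P l τ), L ≤ C := by
    intro l
    induction l with
    | nil =>
      exact ⟨Real.sqrt (∑ j : {i : Fin N // G.deg i = 1}, (0 : Fin N → ℝ) j ^ 2), fun τ _ =>
        ⟨_, G.sqrt_mem_lengths_zero (Submodule.zero_mem _), le_rfl⟩⟩
    | cons b l ih =>
      obtain ⟨C, hC⟩ := ih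
      obtain ⟨C', hC'⟩ := G.exists_mem_lengths_conj (hh b) (hv b)
      refine ⟨C' + C, fun τ hτ => ?_⟩
      obtain ⟨L, hL, hLC⟩ := hC τ hτ
      obtain ⟨L', hL', hLC'⟩ := hC' (τ b) ((norm_le_pi_norm τ b).trans hτ)
      exact ⟨L' + L, G.add_mem_lengths_mul hL' hL, add_le_add hLC' hLC⟩
  obtain ⟨C, hC⟩ := hPlen Finset.univ.toList
  refine ⟨C, ?_⟩
  have hsurj := (hPd Finset.univ.toList).map_nhds_eq_of_surj (by
    rw [Finset.sum_map_toList, LinearMap.range_eq_top]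
    intro z
    have hz : z ∈ Submodule.span ℝ (Set.range ((↑) : T → Fin N → ℝ)) := by
      have hr : Set.range ((↑) : T → Fin N → ℝ) = (T : Set (Fin N → ℝ)) := Subtype.range_coe
      rw [hr, ← hspan]
      trivial
    obtain ⟨c, hc⟩ := (Submodule.mem_span_range_iff_exists_fun ℝ).1 hz
    exact ⟨c, by simpa using hc⟩)
  rw [hP0] at hsurj
  rw [← hsurj, eventually_map]
  filter_upwards [Metric.closedBall_mem_nhds (0 : T → ℝ) one_pos] with τ hτ
  exact hC τ (by simpa using hτ)

theorem tendsto_dil_zero (x : Fin N → ℝ) : Tendsto (fun r => G.dil r x) (𝓝[>] 0) (𝓝 0) := by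
  have h := (G.continuous_dil_left x).tendsto 0
  rw [G.dil_zero] at h
  exact h.mono_left nhdsWithin_le_nhds

theorem lengths_nonempty (x y : Fin N → ℝ) : (G.lengths x y).Nonempty := by
  have h0 : ∀ x, (G.lengths 0 x).Nonempty := by
    intro x
    obtain ⟨C, hC⟩ := G.exists_bound_lengths_nhds
    obtain ⟨r, ⟨L, hL, -⟩, hr⟩ := (((G.tendsto_dil_zero x).eventually hC).and
      self_mem_nhdsWithin).exists
    have hr : 0 < r := hr
    have := G.dil_mem_lengths (inv_nonneg.2 hr.le) hL
    rw [map_zero, G.dil_inv_dil hr.ne'] at this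
    exact ⟨_, this⟩
  obtain ⟨L, hL⟩ := h0 (G.mul (-x) y)
  have := G.mul_left_mem_lengths x hL
  rw [G.mul_zero, G.mul_neg_cancel_left] at this
  exact ⟨L, this⟩

theorem ccDist_triangle (x y z : Fin N → ℝ) : G.ccDist x z ≤ G.ccDist x y + G.ccDist y z := by
  refine le_of_forall_pos_le_add fun ε hε => ?_
  obtain ⟨L, hL, hLε⟩ := exists_lt_of_csInf_lt (G.lengths_nonempty x y)
    (lt_add_of_pos_right (G.ccDist x y) (half_pos hε))
  obtain ⟨L', hL', hLε'⟩ := exists_lt_of_csInf_lt (G.lengths_nonempty y z)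
    (lt_add_of_pos_right (G.ccDist y z) (half_pos hε))
  have := csInf_le (G.bddBelow_lengths x z) (G.add_mem_lengths hL hL')
  rw [G.ccDist_eq x z]
  linarith

theorem ccDist_eq_ccDist_zero (x y : Fin N → ℝ) : G.ccDist x y = G.ccDist 0 (G.mul (-x) y) := by
  rw [← G.ccDist_mul_left (-x), G.neg_mul_self]

/-- The distance from the identity is small near the identity: it is bounded there, and it scales
under dilations. -/
theorem eventually_ccDist_zero_lt {ε : ℝ} (hε : 0 < ε) : ∀ᶠ x in 𝓝 0, G.ccDist 0 x < ε := by
  obtain ⟨C, hC⟩ := G.exists_bound_lengths_nhds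
  set r := ε / (|C| + 1) with hr
  have hr0 : 0 < r := by positivity
  have h1 : Tendsto (G.dil r⁻¹) (𝓝 0) (𝓝 0) := by
    simpa using (G.dil r⁻¹).continuous.tendsto 0
  filter_upwards [h1.eventually hC] with x ⟨L, hL, hLC⟩
  have h2 : G.ccDist 0 (G.dil r⁻¹ x) ≤ C := (csInf_le (G.bddBelow_lengths _ _) hL).trans hLC
  have h3 := G.ccDist_dil hr0 0 (G.dil r⁻¹ x)
  rw [map_zero, G.dil_dil_inv hr0.ne'] at h3
  rw [h3]
  calc r * G.ccDist 0 (G.dil r⁻¹ x) ≤ r * |C| :=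
        mul_le_mul_of_nonneg_left (h2.trans (le_abs_self C)) hr0.le
    _ < r * (|C| + 1) := by gcongr; linarith
    _ = ε := by rw [hr]; field_simp

theorem continuous_ccDist_zero : Continuous (G.ccDist 0) := by
  refine continuous_iff_continuousAt.2 fun x => Metric.tendsto_nhds.2 fun ε hε => ?_
  have h1 : Tendsto (G.mul (-x)) (𝓝 x) (𝓝 0) := by
    simpa [G.neg_mul_self] using (G.contDiff_mul_left (-x)).continuous.tendsto x
  filter_upwards [h1.eventually (G.eventually_ccDist_zero_lt hε)] with y hy
  rw [← G.ccDist_eq_ccDist_zero] at hy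
  rw [Real.dist_eq, abs_lt]
  have h2 := G.ccDist_triangle 0 x y
  have h3 := G.ccDist_triangle 0 y x
  rw [G.ccDist_comm y x] at h3
  constructor <;> linarith

/-! ### Lebesgue measure, translations and dilations -/

theorem det_dil (r : ℝ) : (G.dil r).det = ∏ i, r ^ G.deg i := by
  have h : G.dil r = ContinuousLinearMap.pi fun i =>
      ((r ^ G.deg i) • ContinuousLinearMap.id ℝ ℝ).comp (ContinuousLinearMap.proj i) := by
    ext v i; simp [dil]
  rw [h, ContinuousLinearMap.det_pi]
  simp [ContinuousLinearMap.det]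

theorem det_dil_pos {r : ℝ} (hr : 0 < r) : 0 < (G.dil r).det := by
  rw [det_dil]; exact Finset.prod_pos fun i _ => pow_pos hr _

theorem det_comp (A B : (Fin N → ℝ) →L[ℝ] (Fin N → ℝ)) : (A.comp B).det = A.det * B.det :=
  LinearMap.det_comp _ _

/-- The determinant of the frame is invariant under dilations, hence equal to its value at the
identity. -/
theorem det_dL (x : Fin N → ℝ) : (G.dL x).det = 1 := by
  have hconst : ∀ r : ℝ, 0 < r → (G.dL (G.dil r x)).det = (G.dL x).det := by
    intro r hr
    have h : (G.dil r).comp (G.dL x) = (G.dL (G.dil r x)).comp (G.dil r) :=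
      ContinuousLinearMap.ext fun v => G.dil_dL r x v
    have h2 := congrArg ContinuousLinearMap.det h
    rw [det_comp, det_comp, mul_comm] at h2
    exact (mul_right_cancel₀ (G.det_dil_pos hr).ne' h2).symm
  have h1 : Tendsto (fun r => (G.dL (G.dil r x)).det) (𝓝[>] 0) (𝓝 (G.dL 0).det) :=
    ((ContinuousLinearMap.continuous_det.comp G.contDiff_dL.continuous).tendsto 0).comp
      (G.tendsto_dil_zero x)
  have h2 : Tendsto (fun r => (G.dL (G.dil r x)).det) (𝓝[>] 0) (𝓝 (G.dL x).det) :=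
    tendsto_const_nhds.congr' (by
      filter_upwards [self_mem_nhdsWithin] with r hr using (hconst r hr).symm)
  rw [tendsto_nhds_unique h2 h1, G.dL_zero]
  simp [ContinuousLinearMap.det]

theorem det_fderiv_mul_left (x y : Fin N → ℝ) : (fderiv ℝ (G.mul x) y).det = 1 := by
  have h := congrArg ContinuousLinearMap.det (G.fderiv_mul_left_comp_dL x y)
  rwa [det_comp, G.det_dL, G.det_dL, mul_one] at h

/-- Left translation as a homeomorphism. -/
def mulLeftHomeomorph (x : Fin N → ℝ) : (Fin N → ℝ) ≃ₜ (Fin N → ℝ) where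
  toFun := G.mul x
  invFun := G.mul (-x)
  left_inv := G.neg_mul_cancel_left x
  right_inv := G.mul_neg_cancel_left x
  continuous_toFun := (G.contDiff_mul_left x).continuous
  continuous_invFun := (G.contDiff_mul_left (-x)).continuous

theorem measurePreserving_mul_left (x : Fin N → ℝ) :
    MeasurePreserving (G.mul x) volume volume := by
  refine ⟨(G.contDiff_mul_left x).continuous.measurable, Measure.ext fun S hS => ?_⟩
  rw [Measure.map_apply (G.contDiff_mul_left x).continuous.measurable hS]
  have hpre : MeasurableSet (G.mul x ⁻¹' S) :=
    (G.contDiff_mul_left x).continuous.measurable hS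
  have h := lintegral_abs_det_fderiv_eq_addHaar_image volume hpre
    (fun y _ => (G.differentiable_mul_left x y).hasFDerivAt.hasFDerivWithinAt)
    (G.mulLeftHomeomorph x).injective.injOn
  have hS' : G.mul x '' (G.mul x ⁻¹' S) = S :=
    Set.image_preimage_eq S (G.mulLeftHomeomorph x).surjective
  rw [hS'] at h
  simpa [G.det_fderiv_mul_left] using h

theorem volume_preimage_mul_left (x : Fin N → ℝ) (S : Set (Fin N → ℝ)) :
    volume (G.mul x ⁻¹' S) = volume S :=
  (MeasurePreserving.measure_preimage_equiv (f := (G.mulLeftHomeomorph x).toMeasurableEquiv)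
    (G.measurePreserving_mul_left x) S)

/-- The map `v ↦ x δ_r(v)`, which carries the unit ball to the ball of radius `r` about `x`. -/
noncomputable def zoom (x : Fin N → ℝ) (r : ℝ) (v : Fin N → ℝ) : Fin N → ℝ := G.mul x (G.dil r v)

theorem continuous_zoom (r : ℝ) :
    Continuous fun p : (Fin N → ℝ) × (Fin N → ℝ) => G.zoom p.1 r p.2 :=
  G.continuous_mul.comp (continuous_fst.prodMk ((G.dil r).continuous.comp continuous_snd))

theorem continuous_zoom_right (x : Fin N → ℝ) (r : ℝ) : Continuous (G.zoom x r) :=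
  (G.contDiff_mul_left x).continuous.comp (G.dil r).continuous

theorem volume_preimage_dil {r : ℝ} (hr : 0 < r) (S : Set (Fin N → ℝ)) :
    volume (G.dil r ⁻¹' S) = ENNReal.ofReal ((G.dil r).det)⁻¹ * volume S := by
  have h := Measure.addHaar_preimage_continuousLinearMap volume (f := G.dil r)
    (G.det_dil_pos hr).ne' S
  rw [← abs_of_pos (inv_pos.2 (G.det_dil_pos hr))]
  exact h

theorem volume_preimage_zoom (x : Fin N → ℝ) {r : ℝ} (hr : 0 < r) (S : Set (Fin N → ℝ)) :
    volume (G.zoom x r ⁻¹' S) = ENNReal.ofReal ((G.dil r).det)⁻¹ * volume S := by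
  have h : G.zoom x r ⁻¹' S = G.dil r ⁻¹' (G.mul x ⁻¹' S) := rfl
  rw [h, G.volume_preimage_dil hr, G.volume_preimage_mul_left]

theorem quasiMeasurePreserving_zoom (x : Fin N → ℝ) {r : ℝ} (hr : 0 < r) :
    Measure.QuasiMeasurePreserving (G.zoom x r) volume volume :=
  ⟨(G.continuous_zoom_right x r).measurable, Measure.AbsolutelyContinuous.mk fun S hS h0 => by
    rw [Measure.map_apply (G.continuous_zoom_right x r).measurable hS,
      G.volume_preimage_zoom x hr, h0, MulZeroClass.mul_zero]⟩

theorem ccDist_zoom (x : Fin N → ℝ) {r : ℝ} (hr : 0 < r) (v : Fin N → ℝ) :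
    G.ccDist x (G.zoom x r v) = r * G.ccDist 0 v := by
  have h := G.ccDist_mul_left x 0 (G.dil r v)
  rw [G.mul_zero] at h
  rw [zoom, h]
  simpa using G.ccDist_dil hr 0 v

theorem preimage_zoom_ccBall (x : Fin N → ℝ) {r : ℝ} (hr : 0 < r) :
    G.zoom x r ⁻¹' G.ccBall x r = G.ccBall 0 1 := by
  ext v
  simp only [ccBall, Set.mem_preimage, Set.mem_ofPred_eq, G.ccDist_zoom x hr]
  exact mul_lt_iff_lt_one_right hr

theorem isOpen_ccBall_zero (r : ℝ) : IsOpen (G.ccBall 0 r) :=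
  isOpen_lt G.continuous_ccDist_zero continuous_const

theorem ccBall_zero_mem_nhds {r : ℝ} (hr : 0 < r) : G.ccBall 0 r ∈ 𝓝 0 :=
  G.eventually_ccDist_zero_lt hr

theorem volume_unitBall_ne_zero : volume (G.ccBall 0 1) ≠ 0 :=
  (Measure.measure_pos_of_mem_nhds volume (G.ccBall_zero_mem_nhds one_pos)).ne'

theorem continuous_ccDist : Continuous fun p : (Fin N → ℝ) × (Fin N → ℝ) => G.ccDist p.1 p.2 := by
  have : (fun p : (Fin N → ℝ) × (Fin N → ℝ) => G.ccDist p.1 p.2) =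
      fun p => G.ccDist 0 (G.mul (-p.1) p.2) := funext fun p => G.ccDist_eq_ccDist_zero _ _
  rw [this]
  exact G.continuous_ccDist_zero.comp
    (G.continuous_mul.comp ((continuous_neg.comp continuous_fst).prodMk continuous_snd))

/-- Density quotients at `x` are quotients of volumes in the unit ball. -/
theorem volume_ccBall_inter_div (x : Fin N → ℝ) {r : ℝ} (hr : 0 < r) (A : Set (Fin N → ℝ)) :
    volume (G.ccBall x r ∩ A) / volume (G.ccBall x r) =
      volume (G.ccBall 0 1 ∩ G.zoom x r ⁻¹' A) / volume (G.ccBall 0 1) := by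
  rw [← G.preimage_zoom_ccBall x hr, ← Set.preimage_inter, G.volume_preimage_zoom x hr,
    G.volume_preimage_zoom x hr, ENNReal.mul_div_mul_left]
  · exact (ENNReal.ofReal_pos.2 (inv_pos.2 (G.det_dil_pos hr))).ne'
  · exact ENNReal.ofReal_ne_top

theorem DensityOne.tendsto_unitBall {A : Set (Fin N → ℝ)} {x : Fin N → ℝ}
    (h : G.DensityOne A x) :
    Tendsto (fun r => volume (G.ccBall 0 1 ∩ G.zoom x r ⁻¹' A) / volume (G.ccBall 0 1))
      (𝓝[>] 0) (𝓝 1) := by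
  refine Tendsto.congr' ?_ h
  filter_upwards [self_mem_nhdsWithin] with r hr using G.volume_ccBall_inter_div x hr A

/-- A point of density can exist only if the unit ball has finite volume, as a quotient by `∞`
is `0`. -/
theorem DensityOne.volume_unitBall_ne_top {A : Set (Fin N → ℝ)} {x : Fin N → ℝ}
    (h : G.DensityOne A x) : volume (G.ccBall 0 1) ≠ ⊤ := by
  intro htop
  have h1 := DensityOne.tendsto_unitBall G h
  simp only [htop, ENNReal.div_top] at h1
  exact zero_ne_one (tendsto_nhds_unique tendsto_const_nhds h1)

theorem DensityOne.tendsto_diff {A : Set (Fin N → ℝ)} {x : Fin N → ℝ}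
    (h : G.DensityOne A x) (hA : NullMeasurableSet A volume) :
    Tendsto (fun r => volume (G.ccBall 0 1 \ G.zoom x r ⁻¹' A)) (𝓝[>] 0) (𝓝 0) := by
  have htop := DensityOne.volume_unitBall_ne_top G h
  have h1 := ENNReal.Tendsto.mul_const (b := volume (G.ccBall 0 1))
    (DensityOne.tendsto_unitBall G h) (Or.inr htop)
  simp only [ENNReal.div_mul_cancel G.volume_unitBall_ne_zero htop, one_mul] at h1
  have h2 := ENNReal.Tendsto.sub (tendsto_const_nhds (x := volume (G.ccBall 0 1))) h1
    (Or.inl htop)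
  rw [tsub_self] at h2
  refine h2.congr' ?_
  filter_upwards [self_mem_nhdsWithin] with r hr
  have hnull : NullMeasurableSet (G.zoom x r ⁻¹' A) volume :=
    hA.preimage (G.quasiMeasurePreserving_zoom x hr)
  rw [← measure_inter_add_sdiff₀ (G.ccBall 0 1) hnull, ENNReal.add_sub_cancel_left]
  exact ne_top_of_le_ne_top htop (measure_mono Set.inter_subset_left)

/-- The points at distance `0` from the identity form a null set if the unit ball has finite
volume: this set is invariant under dilations, which change finite positive volumes. -/
theorem volume_ccDist_zero_eq_zero [NeZero N] (htop : volume (G.ccBall 0 1) ≠ ⊤) :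
    volume {v | G.ccDist 0 v = 0} = 0 := by
  have hpre : G.dil 2 ⁻¹' {v | G.ccDist 0 v = 0} = {v | G.ccDist 0 v = 0} := by
    ext v
    have := G.ccDist_dil two_pos 0 v
    rw [map_zero] at this
    simp [this]
  have hfin : volume {v | G.ccDist 0 v = 0} ≠ ⊤ :=
    ne_top_of_le_ne_top htop (measure_mono fun v (hv : G.ccDist 0 v = 0) => by
      simp [ccBall, hv])
  have h := G.volume_preimage_dil two_pos {v | G.ccDist 0 v = 0}
  rw [hpre] at h
  have hdet : 1 < (G.dil 2).det := by
    rw [det_dil]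
    have h1 := Finset.prod_lt_prod_of_nonempty (s := Finset.univ) (f := fun _ : Fin N => (1 : ℝ))
      (g := fun i => (2 : ℝ) ^ G.deg i) (fun _ _ => one_pos)
      (fun i _ => one_lt_pow₀ one_lt_two (by have := G.deg_pos i; omega)) Finset.univ_nonempty
    simpa using h1
  by_contra h0
  have h1 : ENNReal.ofReal ((G.dil 2).det)⁻¹ < 1 := by
    rw [← ENNReal.ofReal_one]
    exact (ENNReal.ofReal_lt_ofReal_iff one_pos).2 (inv_lt_one_of_one_lt₀ hdet)
  exact (ENNReal.mul_lt_mul_left h0 hfin h1).ne (by rw [one_mul]; exact h.symm)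

/-! ### Polynomials -/

/-- The polynomial `∑_{|J|_𝔾 ≤ k} c_J u^J`. -/
noncomputable def poly (k : ℕ) (c : G.multiIndices k → ℝ) (u : Fin N → ℝ) : ℝ :=
  ∑ J, c J * ∏ i, u i ^ (J : Fin N → ℕ) i

variable {G} in
theorem poly_sub {k : ℕ} (c c' : G.multiIndices k → ℝ) (u : Fin N → ℝ) :
    G.poly k (c - c') u = G.poly k c u - G.poly k c' u := by
  simp only [poly, Pi.sub_apply, sub_mul, Finset.sum_sub_distrib]

theorem continuous_poly (k : ℕ) :
    Continuous fun p : (G.multiIndices k → ℝ) × (Fin N → ℝ) => G.poly k p.1 p.2 := by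
  unfold poly
  fun_prop

theorem centredPoly_eq (k : ℕ) (c : (Fin N → ℕ) → ℝ) (x y : Fin N → ℝ) :
    G.centredPoly k c x y = G.poly k (fun J => c J) (G.mul (-x) y) := by
  rw [centredPoly, poly]
  exact (Finset.sum_coe_sort (G.multiIndices k)
    fun J => c J * ∏ i, (G.mul (-x) y i) ^ J i).symm

theorem centredPoly_zoom (k : ℕ) (c : (Fin N → ℕ) → ℝ) (x : Fin N → ℝ) (r : ℝ) (v : Fin N → ℝ) :
    G.centredPoly k c x (G.zoom x r v) = G.poly k (fun J => c J) (G.dil r v) := by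
  rw [centredPoly_eq, zoom, G.neg_mul_cancel_left]

theorem poly_dil (k : ℕ) (c : G.multiIndices k → ℝ) (r : ℝ) (v : Fin N → ℝ) :
    G.poly k c (G.dil r v) =
      ∑ J, c J * (∏ i, v i ^ (J : Fin N → ℕ) i) * r ^ G.hdeg J := by
  refine Finset.sum_congr rfl fun J _ => ?_
  simp only [dil_apply, mul_pow, Finset.prod_mul_distrib, ← pow_mul, Finset.prod_pow_eq_pow_sum,
    hdeg]
  ring

/-- A polynomial that vanishes on a neighbourhood of the identity has zero coefficients. -/
theorem eq_zero_of_poly_eq_zero {k : ℕ} {c : G.multiIndices k → ℝ}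
    (h : ∀ᶠ v in 𝓝 0, G.poly k c v = 0) : c = 0 := by
  obtain ⟨δ, hδ, hball⟩ := Metric.eventually_nhds_iff_ball.1 h
  let Q : MvPolynomial (Fin N) ℝ :=
    ∑ J : G.multiIndices k, MvPolynomial.monomial (Finsupp.equivFunOnFinite.symm J) (c J)
  have hev : ∀ v, MvPolynomial.eval v Q = G.poly k c v := by
    intro v
    simp only [Q, map_sum, MvPolynomial.eval_monomial, poly]
    refine Finset.sum_congr rfl fun J _ => ?_
    rw [Finsupp.prod_fintype _ _ (fun i => pow_zero _)]
    rfl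
  have hQ : Q = 0 := by
    refine MvPolynomial.funext_set (fun _ => Metric.ball (0 : ℝ) δ) (fun i => ?_) fun v hv => ?_
    · rw [Real.ball_eq_Ioo]
      exact Set.Ioo_infinite (by linarith)
    · rw [hev, map_zero]
      refine hball v ?_
      rw [mem_ball_zero_iff, pi_norm_lt_iff hδ]
      exact fun i => mem_ball_zero_iff.1 (hv i trivial)
  funext J
  have hJ := congrArg (MvPolynomial.coeff (Finsupp.equivFunOnFinite.symm (J : Fin N → ℕ))) hQ
  simp only [Q, MvPolynomial.coeff_sum, MvPolynomial.coeff_monomial,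
    EmbeddingLike.apply_eq_iff_eq, MvPolynomial.coeff_zero] at hJ
  simpa [Subtype.coe_inj] using hJ

end CarnotGroup

/-- A real polynomial of degree at most `k` which is `o(r ^ k)` along a sequence `r → 0⁺`
vanishes. -/
theorem Polynomial.eq_zero_of_tendsto_div_pow {p : Polynomial ℝ} {k : ℕ} (hp : p.natDegree ≤ k)
    {r : ℕ → ℝ} (hr0 : ∀ n, 0 < r n) (hr : Tendsto r atTop (𝓝 0))
    (h : Tendsto (fun n => p.eval (r n) / r n ^ k) atTop (𝓝 0)) : p = 0 := by
  by_contra hne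
  obtain ⟨q, hpq, hq⟩ := p.exists_eq_pow_rootMultiplicity_mul_and_not_dvd hne 0
  set m := p.rootMultiplicity 0
  rw [Polynomial.C_0, sub_zero] at hpq hq
  have hmk : m ≤ k := by
    refine le_trans ?_ hp
    rw [hpq, Polynomial.natDegree_X_pow_mul _ (fun h0 => hne (by rw [hpq, h0, mul_zero]))]
    omega
  have h1 : Tendsto (fun n => q.eval (r n)) atTop (𝓝 (q.eval 0)) :=
    (q.continuous.tendsto 0).comp hr
  have h2 : Tendsto (fun n => p.eval (r n) / r n ^ k * r n ^ (k - m)) atTop (𝓝 (0 * 0 ^ (k - m))) :=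
    h.mul (hr.pow _)
  rw [zero_mul] at h2
  have h3 : (fun n => p.eval (r n) / r n ^ k * r n ^ (k - m)) = fun n => q.eval (r n) := by
    funext n
    have hn := (hr0 n).ne'
    rw [hpq, Polynomial.eval_mul, Polynomial.eval_pow, Polynomial.eval_X]
    rw [div_mul_eq_mul_div, div_eq_iff (pow_ne_zero _ hn)]
    calc r n ^ m * q.eval (r n) * r n ^ (k - m) = q.eval (r n) * (r n ^ m * r n ^ (k - m)) := by ring
      _ = q.eval (r n) * r n ^ k := by rw [← pow_add, Nat.add_sub_cancel' hmk]
  rw [h3] at h2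
  refine hq (Polynomial.X_dvd_iff.2 ?_)
  rw [Polynomial.coeff_zero_eq_eval_zero]
  exact tendsto_nhds_unique h1 h2

/-! ### The graph of the approximate Taylor polynomial -/

theorem tendsto_one_div_add_one_nhdsGT :
    Tendsto (fun n : ℕ => 1 / ((n : ℝ) + 1)) atTop (𝓝[>] 0) :=
  tendsto_nhdsWithin_iff.2 ⟨tendsto_one_div_add_atTop_nhds_zero_nat,
    Eventually.of_forall fun _ => Set.mem_Ioi.2 Nat.one_div_pos_of_nat⟩

namespace CarnotGroup

variable {N s : ℕ} (G : CarnotGroup N s)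

/-- The pairs `(x, c)` such that the rescaled functions
`r ^ (-k) (g (x δ_r v) - ∑ c_J (δ_r v)^J)` tend to `0` in measure on the unit ball along
`r = 1 / (n + 1)`. -/
def taylorGraph (g : (Fin N → ℝ) → ℝ) (k : ℕ) :
    Set ((Fin N → ℝ) × (G.multiIndices k → ℝ)) :=
  {p | ∀ m : ℕ, Tendsto (fun n : ℕ => volume.restrict (G.ccBall 0 1)
    {v | (1 / ((n : ℝ) + 1)) ^ k / ((m : ℝ) + 1) <
      |g (G.zoom p.1 (1 / ((n : ℝ) + 1)) v) - G.poly k p.2 (G.dil (1 / ((n : ℝ) + 1)) v)|})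
    atTop (𝓝 0)}

theorem measurableSet_taylorGraph {g : (Fin N → ℝ) → ℝ} (hg : Measurable g) (k : ℕ) :
    MeasurableSet (G.taylorGraph g k) := by
  rw [taylorGraph, Set.ofPred_forall]
  refine MeasurableSet.iInter fun m => measurableSet_tendsto _ fun n => ?_
  set r : ℝ := 1 / ((n : ℝ) + 1)
  have hmeas : MeasurableSet {q : ((Fin N → ℝ) × (G.multiIndices k → ℝ)) × (Fin N → ℝ) |
      r ^ k / ((m : ℝ) + 1) < |g (G.zoom q.1.1 r q.2) - G.poly k q.1.2 (G.dil r q.2)|} := by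
    refine measurableSet_lt measurable_const (Measurable.abs (Measurable.sub ?_ ?_))
    · exact hg.comp ((G.continuous_zoom r).comp
        ((continuous_fst.comp continuous_fst).prodMk continuous_snd)).measurable
    · exact ((G.continuous_poly k).comp ((continuous_snd.comp continuous_fst).prodMk
        ((G.dil r).continuous.comp continuous_snd))).measurable
  exact measurable_measure_prodMk_left hmeas

/-- Uniqueness of the approximate Taylor polynomial. -/
theorem eq_of_mem_taylorGraph {g : (Fin N → ℝ) → ℝ} {k : ℕ} {x : Fin N → ℝ}
    {c c' : G.multiIndices k → ℝ} (h : (x, c) ∈ G.taylorGraph g k)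
    (h' : (x, c') ∈ G.taylorGraph g k) : c = c' := by
  set μ := volume.restrict (G.ccBall 0 1) with hμ
  set r : ℕ → ℝ := fun n => 1 / ((n : ℝ) + 1) with hr
  have hr0 : ∀ n, 0 < r n := fun n => Nat.one_div_pos_of_nat
  -- The rescaled difference of the polynomials tends to `0` in measure.
  have hmeas : TendstoInMeasure μ
      (fun n v => G.poly k (c - c') (G.dil (r n) v) / r n ^ k) atTop fun _ => 0 := by
    rw [tendstoInMeasure_iff_norm]
    intro ε hε
    obtain ⟨m, hm⟩ := exists_nat_one_div_lt (half_pos hε)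
    have hsum := (h m).add (h' m)
    rw [add_zero] at hsum
    refine tendsto_of_tendsto_of_tendsto_of_le_of_le tendsto_const_nhds hsum
      (fun _ => zero_le) fun n => ?_
    refine le_trans (measure_mono fun v hv => ?_) (measure_union_le _ _)
    by_contra hcon
    rw [Set.mem_union, not_or] at hcon
    have hv' : ε ≤ ‖G.poly k (c - c') (G.dil (r n) v) / r n ^ k - 0‖ := hv
    rw [sub_zero, Real.norm_eq_abs, abs_div, abs_of_pos (pow_pos (hr0 n) k),
      le_div_iff₀ (pow_pos (hr0 n) k), poly_sub] at hv'
    have h3 := abs_sub_le (G.poly k c (G.dil (r n) v)) (g (G.zoom x (r n) v))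
      (G.poly k c' (G.dil (r n) v))
    rw [abs_sub_comm (G.poly k c _) (g _)] at h3
    have h4 : r n ^ k / ((m : ℝ) + 1) < ε / 2 * r n ^ k := by
      rw [div_eq_mul_one_div, mul_comm]
      exact mul_lt_mul_of_pos_right hm (pow_pos (hr0 n) k)
    have h1 : |g (G.zoom x (r n) v) - G.poly k c (G.dil (r n) v)| ≤ r n ^ k / ((m : ℝ) + 1) :=
      not_lt.1 hcon.1
    have h2 : |g (G.zoom x (r n) v) - G.poly k c' (G.dil (r n) v)| ≤ r n ^ k / ((m : ℝ) + 1) :=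
      not_lt.1 hcon.2
    linarith
  obtain ⟨ns, hns, hae⟩ := hmeas.exists_seq_tendsto_ae
  have hae0 : ∀ᵐ v ∂μ, G.poly k (c - c') v = 0 := by
    filter_upwards [hae] with v hv
    -- As a function of the ratio, the polynomial along the dilation orbit of `v` has degree `≤ k`.
    let p : Polynomial ℝ := ∑ J : G.multiIndices k,
      Polynomial.C ((c - c') J * ∏ i, v i ^ (J : Fin N → ℕ) i) * Polynomial.X ^ G.hdeg J
    have hp : ∀ t, p.eval t = G.poly k (c - c') (G.dil t v) := by
      intro t
      simp only [p, poly_dil, Polynomial.eval_finsetSum, Polynomial.eval_mul, Polynomial.eval_C,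
        Polynomial.eval_pow, Polynomial.eval_X]
    have hdeg : p.natDegree ≤ k :=
      Polynomial.natDegree_sum_le_of_forall_le _ _ fun J _ =>
        (Polynomial.natDegree_C_mul_X_pow_le _ _).trans (G.mem_multiIndices.1 J.2)
    have hp0 : p = 0 := Polynomial.eq_zero_of_tendsto_div_pow hdeg (fun n => hr0 (ns n))
      (tendsto_one_div_add_atTop_nhds_zero_nat.comp hns.tendsto_atTop)
      (by simpa only [hp] using hv)
    rw [← G.dil_one v, ← hp, hp0, Polynomial.eval_zero]
  have heq : Set.EqOn (G.poly k (c - c')) (fun _ => 0) (G.ccBall 0 1) :=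
    Measure.eqOn_open_of_ae_eq hae0 (G.isOpen_ccBall_zero 1)
      ((G.continuous_poly k).comp (continuous_const.prodMk continuous_id)).continuousOn
      continuousOn_const
  refine sub_eq_zero.1 (G.eq_zero_of_poly_eq_zero ?_)
  filter_upwards [G.ccBall_zero_mem_nhds one_pos] with v hv using heq hv

/-- In measure on the unit ball, the function rescaled about `x` differs from the polynomial
with coefficients `c` by `o(r ^ k)`. The exceptional sets contain the points carried off `D`. -/
def IsScaledApprox (D : Set (Fin N → ℝ)) (f : (Fin N → ℝ) → ℝ) (k : ℕ) (x : Fin N → ℝ)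
    (c : (Fin N → ℕ) → ℝ) : Prop :=
  ∀ ε > 0, Tendsto (fun r => volume (G.ccBall 0 1 ∩
    {v | ¬(G.zoom x r v ∈ D ∧ |f (G.zoom x r v) - G.centredPoly k c x (G.zoom x r v)| ≤ ε * r ^ k)}))
    (𝓝[>] 0) (𝓝 0)

variable {G}
variable {D : Set (Fin N → ℝ)} {f g : (Fin N → ℝ) → ℝ} {k : ℕ} {x : Fin N → ℝ}
  {c : (Fin N → ℕ) → ℝ}

theorem IsScaledApprox.mem_taylorGraph (h : G.IsScaledApprox D f k x c)
    (hfg : ∀ᵐ y, y ∈ D → f y = g y) : (x, fun J : G.multiIndices k => c J) ∈ G.taylorGraph g k := by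
  intro m
  have h1 := (h (1 / ((m : ℝ) + 1)) Nat.one_div_pos_of_nat).comp tendsto_one_div_add_one_nhdsGT
  refine tendsto_of_tendsto_of_tendsto_of_le_of_le tendsto_const_nhds h1
    (fun _ => zero_le) fun n => ?_
  set r : ℝ := 1 / ((n : ℝ) + 1) with hr
  have hr0 : 0 < r := Nat.one_div_pos_of_nat
  rw [Measure.restrict_apply' (G.isOpen_ccBall_zero 1).measurableSet]
  refine measure_mono_ae ?_
  filter_upwards [(G.quasiMeasurePreserving_zoom x hr0).ae hfg] with v hv hmem
  obtain ⟨h2, h3⟩ := hmem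
  refine ⟨h3, fun hcon => ?_⟩
  have h4 := hcon.2
  rw [hv hcon.1, G.centredPoly_zoom, one_div_mul_eq_div] at h4
  exact absurd h2 (not_lt.2 h4)

theorem nullMeasurableSet_inter_preimage (hD : NullMeasurableSet D volume) (hg : Measurable g)
    (hfg : ∀ᵐ y, y ∈ D → f y = g y) (k j : ℕ) (x : Fin N → ℝ) (c : (Fin N → ℕ) → ℝ)
    {B : Set ℝ} (hB : MeasurableSet B) :
    NullMeasurableSet
      (D ∩ {y | |f y - G.centredPoly k c x y| / G.ccDist y x ^ j ∈ B}) volume := by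
  have hcp : Measurable (G.centredPoly k c x) := by
    have : G.centredPoly k c x = fun y => G.poly k (fun J => c J) (G.mul (-x) y) :=
      funext fun y => G.centredPoly_eq k c x y
    rw [this]
    exact ((G.continuous_poly k).comp
      (continuous_const.prodMk (G.contDiff_mul_left (-x)).continuous)).measurable
  have hdist : Measurable fun y => G.ccDist y x :=
    (G.continuous_ccDist.comp (continuous_id.prodMk continuous_const)).measurable
  have hmeas : MeasurableSet {y | |g y - G.centredPoly k c x y| / G.ccDist y x ^ j ∈ B} :=
    (Measurable.div (hg.sub hcp).abs (hdist.pow_const j)) hB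
  refine (hD.inter hmeas.nullMeasurableSet).congr ?_
  filter_upwards [hfg] with y hy
  refine propext (and_congr_right fun hyD => ?_)
  simp only [Set.mem_ofPred_eq, hy hyD]

theorem HasApproxDeriv.isScaledApprox [NeZero N] (hD : NullMeasurableSet D volume)
    (hg : Measurable g) (hfg : ∀ᵐ y, y ∈ D → f y = g y) (h : G.HasApproxDeriv D f k x c) :
    G.IsScaledApprox D f k x c := by
  intro ε hε
  obtain ⟨-, hDx, h⟩ := h
  -- Where the distance vanishes the quotient is `0` by convention and bounds nothing, but these
  -- points form a null set.
  have hZ := G.volume_ccDist_zero_eq_zero (DensityOne.volume_unitBall_ne_top G hDx)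
  have hS := DensityOne.tendsto_diff G (h ε hε)
    (nullMeasurableSet_inter_preimage hD hg hfg k k x c
      (measurableSet_le (measurable_id.sub_const 0).abs measurable_const))
  refine tendsto_of_tendsto_of_tendsto_of_le_of_le' tendsto_const_nhds hS
    (Eventually.of_forall fun _ => zero_le) ?_
  filter_upwards [self_mem_nhdsWithin] with r (hr : 0 < r)
  have hZ' : ∀ᵐ v, G.ccDist 0 v ≠ 0 := by simpa [ae_iff] using hZ
  refine measure_mono_ae ?_
  filter_upwards [hZ'] with v hv0 hmem
  obtain ⟨hvB, hv⟩ := hmem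
  refine ⟨hvB, fun hcon => hv ⟨hcon.1, ?_⟩⟩
  have hd : 0 < G.ccDist 0 v := lt_of_le_of_ne (G.ccDist_nonneg 0 v) (Ne.symm hv0)
  have hd1 : G.ccDist 0 v < 1 := hvB
  have h1 := hcon.2
  rw [G.ccDist_comm, G.ccDist_zoom x hr, sub_zero] at h1
  have h2 := (le_abs_self _).trans h1
  rw [div_le_iff₀ (by positivity)] at h2
  refine h2.trans (mul_le_mul_of_nonneg_left (pow_le_pow_left₀ (by positivity) ?_ k) hε.le)
  exact mul_le_of_le_one_right hr.le hd1.le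

theorem HasApproxTaylor.isScaledApprox [NeZero N] (hk : 1 ≤ k) (hD : NullMeasurableSet D volume)
    (hg : Measurable g) (hfg : ∀ᵐ y, y ∈ D → f y = g y) (h : G.HasApproxTaylor D f k x c) :
    G.IsScaledApprox D f (k - 1) x c := by
  intro ε hε
  obtain ⟨-, hDx, h⟩ := h
  obtain ⟨_, ⟨C, rfl, hC⟩, -⟩ := sInf_lt_iff.1 h
  -- Where the distance vanishes the quotient is `0` by convention and bounds nothing, but these
  -- points form a null set.
  have hZ := G.volume_ccDist_zero_eq_zero (DensityOne.volume_unitBall_ne_top G hDx)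
  have hS := DensityOne.tendsto_diff G hC
    (nullMeasurableSet_inter_preimage hD hg hfg (k - 1) k x c measurableSet_Ioi).compl
  have hsum := hS.add (DensityOne.tendsto_diff G hDx hD)
  rw [add_zero] at hsum
  have hsmall : ∀ᶠ r : ℝ in 𝓝[>] 0, |C| * r ≤ ε := by
    have : Tendsto (fun r : ℝ => |C| * r) (𝓝[>] 0) (𝓝 0) := by
      have h1 : Continuous fun r : ℝ => |C| * r := continuous_const.mul continuous_id
      simpa using (h1.tendsto 0).mono_left nhdsWithin_le_nhds
    exact this.eventually_le_const hε
  refine tendsto_of_tendsto_of_tendsto_of_le_of_le' tendsto_const_nhds hsum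
    (Eventually.of_forall fun _ => zero_le) ?_
  filter_upwards [self_mem_nhdsWithin, hsmall] with r (hr : 0 < r) hrC
  have hZ' : ∀ᵐ v, G.ccDist 0 v ≠ 0 := by simpa [ae_iff] using hZ
  refine le_trans (measure_mono_ae ?_) (measure_union_le _ _)
  filter_upwards [hZ'] with v hv0 hmem
  obtain ⟨hvB, hv⟩ := hmem
  by_contra hcon
  have hcon' := not_or.1 hcon
  have hvD : G.zoom x r v ∈ D := by
    by_contra hnot
    exact hcon'.2 ⟨hvB, hnot⟩
  refine hv ⟨hvD, ?_⟩
  have hd : 0 < G.ccDist 0 v := lt_of_le_of_ne (G.ccDist_nonneg 0 v) (Ne.symm hv0)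
  have hd1 : G.ccDist 0 v < 1 := hvB
  have h1 : ¬ C < |f (G.zoom x r v) - G.centredPoly (k - 1) c x (G.zoom x r v)| /
      G.ccDist (G.zoom x r v) x ^ k := by
    intro hlt
    exact hcon'.1 ⟨hvB, fun hmem => hmem ⟨hvD, hlt⟩⟩
  rw [not_lt, G.ccDist_comm, G.ccDist_zoom x hr, div_le_iff₀ (by positivity)] at h1
  calc |f (G.zoom x r v) - G.centredPoly (k - 1) c x (G.zoom x r v)|
      ≤ C * (r * G.ccDist 0 v) ^ k := h1
    _ ≤ |C| * r ^ k := mul_le_mul (le_abs_self C)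
        (pow_le_pow_left₀ (by positivity) (mul_le_of_le_one_right hr.le hd1.le) k)
        (by positivity) (abs_nonneg C)
    _ = |C| * r * r ^ (k - 1) := by
        rw [_root_.mul_assoc, ← pow_succ', Nat.sub_add_cancel hk]
    _ ≤ ε * r ^ (k - 1) := mul_le_mul_of_nonneg_right hrC (by positivity)

/-- The graph of the coefficients is, over almost all of `D`, a Borel set on which the projection
to the base point is injective, so the coefficients are measurable by the Lusin-Souslin theorem. -/
theorem lebesgueMeasurableOn_coeff (hD : NullMeasurableSet D volume) (hg : Measurable g)
    (hfg : ∀ᵐ y, y ∈ D → f y = g y) (α : (Fin N → ℕ) → (Fin N → ℝ) → ℝ)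
    (h : ∀ᵐ x, x ∈ D → G.IsScaledApprox D f k x fun J => α J x) {J : Fin N → ℕ}
    (hJ : G.hdeg J ≤ k) : LebesgueMeasurableOn D (α J) := by
  intro B hB
  set J' : G.multiIndices k := ⟨J, G.mem_multiIndices.2 hJ⟩
  set S : Set ((Fin N → ℝ) × (G.multiIndices k → ℝ)) :=
    G.taylorGraph g k ∩ {p | p.2 J' ∈ B} with hS
  have hSmeas : MeasurableSet S :=
    (G.measurableSet_taylorGraph hg k).inter
      (((measurable_pi_apply J').comp measurable_snd) hB)
  have himage : MeasurableSet (Prod.fst '' S) := by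
    refine hSmeas.image_of_measurable_injOn measurable_fst ?_
    rintro ⟨x, a⟩ hx ⟨y, b⟩ hy hxy
    obtain rfl : x = y := hxy
    rw [G.eq_of_mem_taylorGraph hx.1 hy.1]
  refine (hD.inter himage.nullMeasurableSet).congr ?_
  filter_upwards [h] with x hx
  refine propext (and_congr_right fun hxD => ?_)
  have hgraph := (hx hxD).mem_taylorGraph hfg
  constructor
  · rintro ⟨⟨y, a⟩, hy, rfl⟩
    have := G.eq_of_mem_taylorGraph hy.1 hgraph
    have hB' : a J' ∈ B := hy.2
    rw [this] at hB'
    exact hB'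
  · intro hxB
    exact ⟨_, ⟨hgraph, hxB⟩, rfl⟩

end CarnotGroup

theorem LebesgueMeasurableOn.exists_measurable {N : ℕ} {D : Set (Fin N → ℝ)}
    (hD : NullMeasurableSet D volume) {f : (Fin N → ℝ) → ℝ} (hf : LebesgueMeasurableOn D f) :
    ∃ g, Measurable g ∧ ∀ᵐ y, y ∈ D → f y = g y := by
  have hnull : NullMeasurable (D.indicator f) volume := by
    intro B hB
    classical
    rw [Set.indicator_preimage, Set.ite, Set.inter_comm]
    exact (hf B hB).union
      (NullMeasurableSet.inter (measurable_zero hB).nullMeasurableSet hD.compl)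
  obtain ⟨g, hg, hfg⟩ := hnull.aemeasurable
  refine ⟨g, hg, ?_⟩
  filter_upwards [hfg] with y hy hyD
  rw [← hy, Set.indicator_of_mem hyD]

theorem proposition4p1 {N s : ℕ} (G : CarnotGroup N s) (D : Set (Fin N → ℝ))
    (hD : NullMeasurableSet D volume) (f : (Fin N → ℝ) → ℝ) (hf : LebesgueMeasurableOn D f) :
    (∀ (k : ℕ) (α : (Fin N → ℕ) → (Fin N → ℝ) → ℝ),
      (∀ᵐ x₀ ∂volume, x₀ ∈ D → G.HasApproxDeriv D f k x₀ (fun J => α J x₀)) →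
      ∀ J, G.hdeg J ≤ k → LebesgueMeasurableOn D (α J)) ∧
    (∀ (k : ℕ), 1 ≤ k → ∀ (α : (Fin N → ℕ) → (Fin N → ℝ) → ℝ),
      (∀ᵐ x₀ ∂volume, x₀ ∈ D → G.HasApproxTaylor D f k x₀ (fun J => α J x₀)) →
      ∀ J, G.hdeg J ≤ k - 1 → LebesgueMeasurableOn D (α J)) := by
  rcases Nat.eq_zero_or_pos N with rfl | hN
  · -- On a one-point space every set is measurable.
    have h0 : ∀ a : (Fin 0 → ℝ) → ℝ, LebesgueMeasurableOn D a := fun a B _ =>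
      (Subsingleton.measurableSet (s := D ∩ a ⁻¹' B)).nullMeasurableSet
    exact ⟨fun _ _ _ _ _ => h0 _, fun _ _ _ _ _ _ => h0 _⟩
  have : NeZero N := ⟨hN.ne'⟩
  obtain ⟨g, hg, hfg⟩ := hf.exists_measurable hD
  refine ⟨fun k α h J hJ => ?_, fun k hk α h J hJ => ?_⟩
  · refine CarnotGroup.lebesgueMeasurableOn_coeff hD hg hfg α ?_ hJ
    filter_upwards [h] with x hx hxD using (hx hxD).isScaledApprox hD hg hfg
  · refine CarnotGroup.lebesgueMeasurableOn_coeff hD hg hfg α ?_ hJ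
    filter_upwards [h] with x hx hxD using (hx hxD).isScaledApprox hk hD hg hfg
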